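/- Let $f\colon S\to\{0,1\}$ with $S\subseteq\{0,1\}^n$ be a (possibly partial) Boolean function. For $k\ge 1$ let $f^k=f\circ\cdots\circ f$ ($k$ copies), where $f\circ g$ denotes block composition: $(f\circ g)(y^1\cdots y^{n})=f(g(y^1)\cdots g(y^{n}))$, defined when every $y^i\in\mathrm{Dom}(g)$ and $g(y^1)\cdots g(y^n)\in\mathrm{Dom}(f)$. For a measure $M$ of Boolean functions, its composition limit is $M^*(f)=\lim_{k\to\infty}M(f^k)^{1/k}$. A certificate for $x\in\mathrm{Dom}(f)$ is a partial assignment $p\in\{0,1,*\}^n$ that agrees with $x$ on its non-$*$ positions and such that $f(y)=f(x)$ for all $y\in\mathrm{Dom}(f)$ that agree with $p$ in the same way; its size $|p|$ is the number of non-$*$ positions. Let $\mathrm{C}(f)$ be the certificate complexity, i.e. the maximum over $x\in\mathrm{Dom}(f)$ of the least size of a certificate for $x$ (with maximum $0$ if the domain is empty). Let $\mathrm{Q}(f)$ be the bounded-error quantum query complexity: the least number of queries of a quantum query algorithm that on every $x\in\mathrm{Dom}(f)$ outputs $f(x)$ with probability at least $2/3$. Let $\mathrm{Q}_{\mathrm{C}}(f)$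 be the least cost of a quantum query algorithm that on every $x\in\mathrm{Dom}(f)$ outputs a certificate for $x$ with probability at least $1/2$ and otherwise outputs a failure symbol $\bot$; the cost is the number of quantum queries plus the largest size of a certificate that the algorithm may output on an input in $\mathrm{Dom}(f)$. Then the composition limits $\mathrm{Q}^*(f)$, $\mathrm{C}^*(f)$ and $\mathrm{Q}_{\mathrm{C}}^*(f)$ all exist, and \[\mathrm{Q}_{\mathrm{C}}^*(f)=\max\{\mathrm{Q}^*(f),\mathrm{C}^*(f)\}.\] -/

import Mathlib

open Filter Topology

/-- A possibly partial Boolean function on `arity` bits, as a map `{0,1}^arity → {0,1,*}`;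
the symbol `*` (outside the promise) is `none`. -/
structure PartialBoolFun where
  arity : ℕ
  toFun : (Fin arity → Bool) → Option Bool

namespace PartialBoolFun

/-- The domain (promise) of `f`: the strings on which the value is not `*`. -/
def Dom (f : PartialBoolFun) : Set (Fin f.arity → Bool) := {x | (f.toFun x).isSome}

/-- The identity function on one bit. -/
def id₁ : PartialBoolFun where
  arity := 1
  toFun x := some (x 0)

/-- The `i`-th of the `n` consecutive blocks of length `m` of a string of length `n * m`. -/
def block {n m : ℕ} (x : Fin (n * m) → Bool) (i : Fin n) : Fin m → Bool :=
  fun j => x (finProdFinEquiv (i, j))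

/-- Block composition `f ∘ g`: apply `g` to each of `f.arity` blocks and `f` to the results; the
input is in the domain iff all blocks are in the domain of `g` and the string of results is in the
domain of `f`. -/
def comp (f g : PartialBoolFun) : PartialBoolFun where
  arity := f.arity * g.arity
  toFun x :=
    if h : ∀ i : Fin f.arity, (g.toFun (block x i)).isSome then
      f.toFun fun i => (g.toFun (block x i)).get (h i)
    else none

/-- Recursive composition `f^k = f ∘ ⋯ ∘ f`, with `f^0` the identity function on one bit. -/
def iter (f : PartialBoolFun) : ℕ → PartialBoolFun
  | 0 => id₁
  | k + 1 => f.comp (f.iter k)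

end PartialBoolFun

/-- `L` is the composition limit `lim_{k → ∞} M(f^k)^{1/k}` (in particular, the limit exists). -/
def HasCompositionLimit (M : PartialBoolFun → ℝ) (f : PartialBoolFun) (L : ℝ) : Prop :=
  Tendsto (fun k : ℕ => M (f.iter k) ^ (1 / (k : ℝ))) atTop (𝓝 L)

/-- A partial assignment on `n` bits, a string in `{0,1,*}^n`, where `*` is `none`. -/
abbrev PartialAssignment (n : ℕ) : Type := Fin n → Option Bool

namespace PartialAssignment

/-- The number `|p|` of bits that the partial assignment reveals. -/
def size {n : ℕ} (p : PartialAssignment n) : ℕ :=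
  (Finset.univ.filter fun i => (p i).isSome).card

/-- `p ⊆ x`: the string `x` agrees with all the bits revealed by `p`. -/
def Sub {n : ℕ} (p : PartialAssignment n) (x : Fin n → Bool) : Prop :=
  ∀ i b, p i = some b → x i = b

end PartialAssignment

/-- `p` is a certificate for the input `x` with respect to `f`. -/
def IsCertificate (f : PartialBoolFun) (x : Fin f.arity → Bool)
    (p : PartialAssignment f.arity) : Prop :=
  p.Sub x ∧ ∀ y ∈ f.Dom, p.Sub y → f.toFun y = f.toFun x

/-- The certificate complexity `C_x(f)` of `f` at `x`: the least size of a certificate for `x`. -/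
noncomputable def certAt (f : PartialBoolFun) (x : Fin f.arity → Bool) : ℕ :=
  sInf {s | ∃ p, IsCertificate f x p ∧ p.size = s}

open Classical in
/-- The certificate complexity `C(f)`, the maximum of `C_x(f)` over `x ∈ Dom(f)`
(and `0` if the domain is empty). -/
noncomputable def certComplexity (f : PartialBoolFun) : ℕ :=
  (Finset.univ.filter fun x => x ∈ f.Dom).sup (certAt f)

/-- Labels `|i, b, w⟩` of the computational basis of a quantum query algorithm on `n` bits: a query
index `i` (`none` for "no query"), an answer bit `b` and the contents `w` of the work register. -/
abbrev QBasis (n : ℕ) (W : Type) : Type := Option (Fin n) × Bool × W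

/-- The action of the query oracle for `x` on basis labels, `|i, b, w⟩ ↦ |i, b ⊕ xᵢ, w⟩`. It is an
involution. -/
def oracleMap {n : ℕ} {W : Type} (x : Fin n → Bool) : QBasis n W → QBasis n W
  | (none, b, w) => (none, b, w)
  | (some i, b, w) => (some i, xor b (x i), w)

/-- The query oracle for `x` as a linear operator on state vectors; as `oracleMap x` is an
involution, it sends the basis vector `|s⟩` to `|oracleMap x s⟩`. -/
def applyOracle {n : ℕ} {W : Type} (x : Fin n → Bool) (ψ : QBasis n W → ℂ) : QBasis n W → ℂ :=
  fun s => ψ (oracleMap x s)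

/-- A quantum query algorithm on `n` bits with outputs in `Out`. The work register has the
computational basis `W`. The algorithm starts in a basis state, applies
`U₀, O_x, U₁, O_x, …, O_x, U_T` with `T = queries`, and measures in the computational basis; the
output is a function of the measured label. Of the unitaries only `U₀, …, U_T` are used. -/
structure QueryAlgorithm (n : ℕ) (W Out : Type) [Fintype W] [DecidableEq W] where
  queries : ℕ
  init : QBasis n W
  U : ℕ → Matrix.unitaryGroup (QBasis n W) ℂ
  output : QBasis n W → Out

namespace QueryAlgorithm

/-- The state on input `x` after `t` queries and the unitary that follows them. -/
noncomputable def state {n : ℕ} {W Out : Type} [Fintype W] [DecidableEq W]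
    (A : QueryAlgorithm n W Out) (x : Fin n → Bool) : ℕ → (QBasis n W → ℂ)
  | 0 => (A.U 0).1.mulVec (Pi.single A.init 1)
  | t + 1 => (A.U (t + 1)).1.mulVec (applyOracle x (A.state x t))

open Classical in
/-- The probability that the output of the algorithm on input `x` lies in `E`. -/
noncomputable def prob {n : ℕ} {W Out : Type} [Fintype W] [DecidableEq W]
    (A : QueryAlgorithm n W Out) (x : Fin n → Bool) (E : Set Out) : ℝ :=
  ∑ s : QBasis n W, if A.output s ∈ E then ‖A.state x A.queries s‖ ^ 2 else 0

/-- The algorithm computes `f` with error at most `1/3` on every input in the domain. -/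
def Computes {f : PartialBoolFun} {W : Type} [Fintype W] [DecidableEq W]
    (A : QueryAlgorithm f.arity W Bool) : Prop :=
  ∀ x ∈ f.Dom, 2 / 3 ≤ A.prob x {b | f.toFun x = some b}

/-- The algorithm outputs partial assignments or the failure symbol `⊥` (which is `none`). On every
input `x` in the domain of `f` it outputs a certificate for `x` with probability at least `1/2`; it
never outputs a partial assignment that is not a certificate for `x` (so that it outputs `⊥` when
it fails), and all certificates that it may output have size at most `s`. -/
def FindsCertificate {f : PartialBoolFun} {W : Type} [Fintype W] [DecidableEq W]
    (A : QueryAlgorithm f.arity W (Option (PartialAssignment f.arity))) (s : ℕ) : Prop :=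
  ∀ x ∈ f.Dom,
    1 / 2 ≤ A.prob x {o | ∃ p, o = some p ∧ IsCertificate f x p} ∧
    ∀ p, A.prob x {some p} ≠ 0 → IsCertificate f x p ∧ p.size ≤ s

end QueryAlgorithm

/-- The bounded-error quantum query complexity `Q(f)`. -/
noncomputable def quantumComplexity (f : PartialBoolFun) : ℕ :=
  sInf {T | ∃ (W : Type) (_ : Fintype W) (_ : DecidableEq W)
    (A : QueryAlgorithm f.arity W Bool), A.Computes (f := f) ∧ T = A.queries}

/-- The certificate-finding quantum query complexity `Q_C(f)`: the least cost of a quantum algorithm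
that finds certificates of `f`, where the cost is the number of queries plus the (worst-case) size
of the certificate that is output. -/
noncomputable def certQuantumComplexity (f : PartialBoolFun) : ℕ :=
  sInf {c | ∃ (W : Type) (_ : Fintype W) (_ : DecidableEq W)
    (A : QueryAlgorithm f.arity W (Option (PartialAssignment f.arity))) (s : ℕ),
    A.FindsCertificate (f := f) s ∧ c = A.queries + s}

/-! The lower bound holds at each level: a certificate finder exhibits certificates within its cost,
so C ≤ Q_C, and two runs of it reveal the value with probability at least 3/4, so Q ≤ 2 Q_C. For the
upper bound, split f^(j+k) as f^j ∘ f^k with j fixed. Compute all block values by bounded-error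
search, fix a certificate of f^j for the resulting string, and find certificates only in the blocks
it reveals. This gives Q_C(f^(j+k)) ≤ E_j Q(f^k) + D j C(f^j) Q_C(f^k). The wasteful factor E_j,
which contains the arity of f^j, multiplies only Q(f^k) and does not depend on k, while (D j
C(f^j))^(1/j) tends to C*. Hence Q_C(f^k) grows no faster than any α^k with α > max(Q*, C*)
(`certQuantumComplexity_comp_le`, `tendsto_max_of_recurrence`).

The limits Q* and C* come from Fekete's lemma. C is submultiplicative. Q is so up to a factor linear
in j, since error reduction costs a logarithm of the outer query count and that count is at most
exponential in j (`quantumComplexity_comp_le`).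

Quantum algorithms are handled through Gram matrices of their states over all inputs. Unitaries
leave the Gram matrix unchanged, and a query splits it into positive semidefinite parts and
multiplies each entrywise by a sign pattern. Conversely, families with equal Gram matrices differ by
a unitary, so such matrix paths are exactly query algorithms. Tensoring, branching, reversal and
hybrid arguments then become matrix manipulations. -/

set_option linter.unusedSectionVars false

open scoped ComplexOrder Matrix

/-! ### Gram matrices and unitary equivalence. -/

section Gram

variable {X S : Type} [Fintype X] [Fintype S]

/-- The Gram matrix of a family of vectors. -/
def vecGram (u : X → S → ℂ) : Matrix X X ℂ := Matrix.of fun x y => ∑ s, star (u x s) * u y s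

omit [Fintype X] in
theorem vecGram_eq_sum (u : X → S → ℂ) :
    vecGram u = ∑ s, Matrix.vecMulVec (star fun x => u x s) (fun x => u x s) := by
  ext x y
  simp [vecGram, Matrix.sum_apply, Matrix.vecMulVec_apply]

theorem posSemidef_vecGram (u : X → S → ℂ) : (vecGram u).PosSemidef := by
  rw [vecGram_eq_sum]
  exact Matrix.posSemidef_sum _ fun s _ => Matrix.posSemidef_vecMulVec_star_self _

theorem Matrix.PosSemidef.exists_vecGram {M : Matrix X X ℂ} (hM : M.PosSemidef) :
    ∃ u : X → X → ℂ, vecGram u = M := by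
  classical
  open scoped MatrixOrder in
  obtain ⟨B, hB⟩ := CStarAlgebra.nonneg_iff_eq_star_mul_self.mp (Matrix.nonneg_iff_posSemidef.mpr hM)
  refine ⟨fun x s => B s x, ?_⟩
  ext x y
  rw [hB]
  simp [vecGram, Matrix.mul_apply, Matrix.star_apply]

/-- Families of vectors with the same Gram matrix are related by a unitary. -/
theorem exists_unitary_of_vecGram_eq [DecidableEq S] (u w : X → S → ℂ)
    (h : vecGram u = vecGram w) :
    ∃ U : Matrix.unitaryGroup S ℂ, ∀ x, U.1.mulVec (u x) = w x := by
  have : DecidableEq X := Classical.decEq X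
  let u' : X → EuclideanSpace ℂ S := fun x => WithLp.toLp 2 (u x)
  let w' : X → EuclideanSpace ℂ S := fun x => WithLp.toLp 2 (w x)
  have hin : ∀ x y, inner ℂ (u' x) (u' y) = inner ℂ (w' x) (w' y) := by
    intro x y
    have := congrFun (congrFun h x) y
    simp only [vecGram, Matrix.of_apply] at this
    simp only [u', w', EuclideanSpace.inner_toLp_toLp, dotProduct, Pi.star_apply]
    simpa [mul_comm] using this
  let Lu : (X → ℂ) →ₗ[ℂ] EuclideanSpace ℂ S := Fintype.linearCombination ℂ u'
  let Lw : (X → ℂ) →ₗ[ℂ] EuclideanSpace ℂ S := Fintype.linearCombination ℂ w'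
  have hnorm : ∀ c, ‖Lu c‖ = ‖Lw c‖ := by
    intro c
    have : inner ℂ (Lu c) (Lu c) = inner ℂ (Lw c) (Lw c) := by
      simp only [Lu, Lw, Fintype.linearCombination_apply, sum_inner, inner_sum, inner_smul_left,
        inner_smul_right, hin]
    rw [inner_self_eq_norm_sq_to_K, inner_self_eq_norm_sq_to_K] at this
    have h2 : ‖Lu c‖ ^ 2 = ‖Lw c‖ ^ 2 := by exact_mod_cast this
    exact (sq_eq_sq₀ (norm_nonneg _) (norm_nonneg _)).mp h2
  obtain ⟨g, hg⟩ := Lu.rangeRestrict.exists_rightInverse_of_surjective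
    (LinearMap.range_eq_top.mpr Lu.surjective_rangeRestrict)
  have hg' : ∀ v : LinearMap.range Lu, Lu (g v) = v := by
    intro v
    have := LinearMap.congr_fun hg v
    exact congrArg Subtype.val this
  -- The map `Lu c ↦ Lw c` is well defined and isometric because `‖Lu c‖ = ‖Lw c‖`; `g` merely picks
  -- preimages. In finite dimension it extends to an isometry of the whole space.
  let V0 : LinearMap.range Lu →ₗᵢ[ℂ] EuclideanSpace ℂ S :=
    { toLinearMap := Lw ∘ₗ g
      norm_map' := fun v => by
        simp only [LinearMap.comp_apply]
        rw [← hnorm, hg']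
        rfl }
  let V := V0.extend
  have hV : ∀ c, V (Lu c) = Lw c := by
    intro c
    have h1 : V (Lu c) = V0 ⟨Lu c, LinearMap.mem_range_self _ c⟩ :=
      V0.extend_apply ⟨Lu c, LinearMap.mem_range_self _ c⟩
    rw [h1]
    change Lw (g _) = Lw c
    rw [← sub_eq_zero, ← map_sub, ← norm_eq_zero, ← hnorm, map_sub, hg', sub_self, norm_zero]
  have hVx : ∀ x, V (u' x) = w' x := by
    intro x
    have := hV (Pi.single x 1)
    simpa [Lu, Lw, Fintype.linearCombination_apply_single] using this
  let M : Matrix S S ℂ := LinearMap.toMatrix (EuclideanSpace.basisFun S ℂ).toBasis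
    (EuclideanSpace.basisFun S ℂ).toBasis V.toLinearMap
  have hM : ∀ v : EuclideanSpace ℂ S, M.mulVec (WithLp.ofLp v) = WithLp.ofLp (V v) := by
    intro v
    have := LinearMap.toMatrix_mulVec_repr (EuclideanSpace.basisFun S ℂ).toBasis
      (EuclideanSpace.basisFun S ℂ).toBasis V.toLinearMap v
    exact this
  refine ⟨⟨M, ?_⟩, fun x => ?_⟩
  · rw [Matrix.mem_unitaryGroup_iff']
    ext i j
    have h1 : inner ℂ (V (EuclideanSpace.single i 1)) (V (EuclideanSpace.single j 1))
        = (1 : Matrix S S ℂ) i j := by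
      rw [V.inner_map_map]
      simp [EuclideanSpace.inner_single_left, Matrix.one_apply]
    rw [← h1]
    have h2 : ∀ j, WithLp.ofLp (V (EuclideanSpace.single j 1)) = fun s => M s j := by
      intro j
      rw [← hM]
      ext s
      simp
    simp only [Matrix.mul_apply, Matrix.star_apply, PiLp.inner_apply, h2]
    simp [mul_comm]
  · have := hM (u' x)
    rw [hVx] at this
    exact this

theorem vecGram_mulVec [DecidableEq S] (U : Matrix.unitaryGroup S ℂ) (u : X → S → ℂ) :
    vecGram (fun x => U.1.mulVec (u x)) = vecGram u := by
  have h : ∀ v : X → S → ℂ, ∀ x y, vecGram v x y = star (v x) ⬝ᵥ v y := fun _ _ _ => rfl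
  ext x y
  rw [h, h, Matrix.star_mulVec, ← Matrix.dotProduct_mulVec, Matrix.mulVec_mulVec,
    ← Matrix.star_eq_conjTranspose, Matrix.UnitaryGroup.star_mul_self, Matrix.one_mulVec]

-- Projections onto the values of the label `ℓ` are orthogonal and sum to the identity, so measuring
-- `ℓ` splits the Gram matrix.
omit [Fintype X] in
theorem sum_vecGram_mask {Q : Type} [Fintype Q] [DecidableEq Q] (ℓ : S → Q) (u : X → S → ℂ) :
    ∑ q, vecGram (fun x s => if ℓ s = q then u x s else 0) = vecGram u := by
  ext x y
  simp only [Matrix.sum_apply, vecGram, Matrix.of_apply]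
  rw [Finset.sum_comm]
  refine Finset.sum_congr rfl fun s _ => ?_
  rw [Finset.sum_eq_single (ℓ s)] <;> simp +contextual [eq_comm]

/-- A decomposition of a principal submatrix of a positive semidefinite matrix into positive
semidefinite matrices extends to the whole matrix. -/
theorem Matrix.PosSemidef.exists_decomposition_extending {X' Q : Type} [Fintype X'] [Fintype Q]
    [Nonempty Q] (e : X → X') {G : Matrix X' X' ℂ} (hG : G.PosSemidef) (N : Q → Matrix X X ℂ)
    (hN : ∀ q, (N q).PosSemidef) (h : G.submatrix e e = ∑ q, N q) :
    ∃ N' : Q → Matrix X' X' ℂ, (∀ q, (N' q).PosSemidef) ∧ ∑ q, N' q = G ∧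
      ∀ q, (N' q).submatrix e e = N q := by
  classical
  obtain ⟨v, hv⟩ := hG.exists_vecGram
  choose n hn using fun q => (hN q).exists_vecGram
  -- The space has room for a realization of `G` and, in orthogonal sectors `q`, for realizations of
  -- all `N q`. A unitary carries the first to the second on the image of `e`; measuring the sector
  -- then splits all of `G`.
  let u : X' → X' ⊕ (Q × X) → ℂ := fun a => Sum.elim (v a) fun _ => 0
  let w : X → X' ⊕ (Q × X) → ℂ := fun x => Sum.elim (fun _ => 0) (fun p => n p.1 x p.2)
  have hu : vecGram u = G := by
    rw [← hv]
    ext x y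
    simp [vecGram, u]
  have hw : vecGram w = ∑ q, N q := by
    simp_rw [← hn]
    ext x y
    simp [vecGram, w, Fintype.sum_prod_type, Matrix.sum_apply]
  obtain ⟨U, hU⟩ := exists_unitary_of_vecGram_eq (fun x => u (e x)) w (by
    rw [hw, ← h, ← hu]
    rfl)
  -- The vectors `w` vanish on the summand `X'`, so its label affects only how the vectors outside
  -- the image of `e` are split.
  let ℓ : X' ⊕ (Q × X) → Q := Sum.elim (fun _ => Classical.arbitrary Q) Prod.fst
  refine ⟨fun q => vecGram (fun a s => if ℓ s = q then U.1.mulVec (u a) s else 0),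
    fun q => posSemidef_vecGram _, ?_, fun q => ?_⟩
  · rw [sum_vecGram_mask ℓ (fun a => U.1.mulVec (u a)), vecGram_mulVec, hu]
  · rw [← hn]
    ext x y
    simp only [vecGram, Matrix.submatrix_apply, Matrix.of_apply, hU]
    have hs : ∀ s, star (if ℓ s = q then w x s else 0) * (if ℓ s = q then w y s else 0) =
        Sum.elim (fun _ => 0)
          (fun p => if p.1 = q then star (n p.1 x p.2) * n p.1 y p.2 else 0) s := by
      rintro (s | p)
      · by_cases hq : ℓ (Sum.inl s) = q <;> simp [hq, w]
      · by_cases hq : p.1 = q <;> simp [hq, w, ℓ]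
    simp only [hs, Fintype.sum_sum_type, Fintype.sum_prod_type, Sum.elim_inl, Sum.elim_inr]
    rw [Finset.sum_eq_single q] <;> simp +contextual

end Gram

/-! ### Query computations as paths of Gram matrices. -/

section GramPath

variable {X Y ι κ : Type} [Fintype X] [Fintype Y] [Fintype ι] [Fintype κ]

/-- The phase `(-1)^b`. -/
def boolSign (b : Bool) : ℂ := if b then -1 else 1

@[simp] theorem boolSign_mul_self (b : Bool) : boolSign b * boolSign b = 1 := by
  cases b <;> simp [boolSign]

@[simp] theorem star_boolSign (b : Bool) : star (boolSign b) = boolSign b := by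
  cases b <;> simp [boolSign]

/-- The effect of the phase query `q` on Gram matrices, for inputs with bit strings `β x`. -/
def phase (β : X → ι → Bool) : Option ι → Matrix X X ℂ
  | none => Matrix.of fun _ _ => 1
  | some i => Matrix.of fun x y => boolSign (β x i) * boolSign (β y i)

omit [Fintype X] [Fintype ι] in
theorem phase_apply_eq_one (β : X → ι → Bool) (q : Option ι) {x y : X} (h : β x = β y) :
    phase β q x y = 1 := by
  cases q <;> simp [phase, h]

omit [Fintype X] [Fintype ι] in
theorem phase_hadamard_phase (β : X → ι → Bool) (q : Option ι) (M : Matrix X X ℂ) :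
    phase β q ⊙ (phase β q ⊙ M) = M := by
  ext x y
  cases q with
  | none => simp [phase]
  | some i =>
    simp only [phase, Matrix.hadamard_apply, Matrix.of_apply]
    linear_combination (boolSign (β y i) * boolSign (β y i) * M x y) * boolSign_mul_self (β x i) +
      (M x y) * boolSign_mul_self (β y i)

theorem posSemidef_ones : (Matrix.of fun _ _ : X => (1 : ℂ)).PosSemidef := by
  convert Matrix.posSemidef_vecMulVec_star_self (fun _ : X => (1 : ℂ)) using 1
  ext x y
  simp [Matrix.vecMulVec_apply]

theorem posSemidef_phase (β : X → ι → Bool) (q : Option ι) : (phase β q).PosSemidef := by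
  cases q with
  | none => exact posSemidef_ones
  | some i =>
    convert Matrix.posSemidef_vecMulVec_star_self (fun x : X => boolSign (β x i)) using 1
    ext x y
    simp only [phase, Matrix.vecMulVec_apply, Matrix.of_apply, Pi.star_apply, star_boolSign]

/-- The Gram matrix after one query, for the decomposition `N` of the state according to the query
register. -/
def queryUpdate (β : X → ι → Bool) (N : Option ι → Matrix X X ℂ) : Matrix X X ℂ :=
  ∑ q, phase β q ⊙ N q

/-- `GramPath β T G H`: with `T` queries to the inputs `β x`, a family of states with Gram matrix
`G` can be turned into one with Gram matrix `H`. -/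
def GramPath (β : X → ι → Bool) : ℕ → Matrix X X ℂ → Matrix X X ℂ → Prop
  | 0, G, H => G = H
  | T + 1, G, H => ∃ N : Option ι → Matrix X X ℂ,
      (∀ q, (N q).PosSemidef) ∧ G = ∑ q, N q ∧ GramPath β T (queryUpdate β N) H

theorem posSemidef_queryUpdate {β : X → ι → Bool} {N : Option ι → Matrix X X ℂ}
    (hN : ∀ q, (N q).PosSemidef) : (queryUpdate β N).PosSemidef :=
  Matrix.posSemidef_sum _ fun q _ => (posSemidef_phase β q).hadamard (hN q)

theorem queryUpdate_hadamard (β : X → ι → Bool) (M : Matrix X X ℂ)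
    (N : Option ι → Matrix X X ℂ) :
    queryUpdate β (fun q => M ⊙ N q) = M ⊙ queryUpdate β N := by
  ext x y
  simp only [queryUpdate, Matrix.sum_apply, Matrix.hadamard_apply, Finset.mul_sum]
  exact Finset.sum_congr rfl fun q _ => by ring

theorem Matrix.hadamard_sum' {Q : Type} [Fintype Q] (M : Matrix X X ℂ) (N : Q → Matrix X X ℂ) :
    M ⊙ ∑ q, N q = ∑ q, M ⊙ N q := by
  ext x y
  simp only [Matrix.sum_apply, Matrix.hadamard_apply, Finset.mul_sum]

theorem Matrix.submatrix_sum' {Q : Type} [Fintype Q] (N : Q → Matrix Y Y ℂ) (φ : X → Y) :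
    (∑ q, N q).submatrix φ φ = ∑ q, (N q).submatrix φ φ := by
  ext x y
  simp only [Matrix.sum_apply, Matrix.submatrix_apply]

namespace GramPath

variable {β : X → ι → Bool} {S T : ℕ} {G H K M : Matrix X X ℂ}

theorem trans (h : GramPath β S G H) (h' : GramPath β T H K) : GramPath β (S + T) G K := by
  induction S generalizing G with
  | zero =>
    obtain rfl : G = H := h
    simpa using h'
  | succ S ih =>
    obtain ⟨N, hN, hG, hp⟩ := h
    rw [Nat.add_right_comm]
    exact ⟨N, hN, hG, ih hp⟩

theorem posSemidef (h : GramPath β T G H) (hG : G.PosSemidef) : H.PosSemidef := by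
  induction T generalizing G with
  | zero => exact (show G = H from h) ▸ hG
  | succ T ih =>
    obtain ⟨N, hN, -, hp⟩ := h
    exact ih hp (posSemidef_queryUpdate hN)

/-- The same operations are applied to both vectors, so inner products survive. For `x = y` this is
conservation of norm; for two copies of one input it conserves their distance. -/
theorem apply_eq (h : GramPath β T G H) {x y : X} (hxy : β x = β y) : H x y = G x y := by
  induction T generalizing G with
  | zero => exact (show G = H from h) ▸ rfl
  | succ T ih =>
    obtain ⟨N, -, rfl, hp⟩ := h
    rw [ih hp]
    simp [queryUpdate, Matrix.sum_apply, phase_apply_eq_one β _ hxy]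

/-- Introduction rule for one query, with a decomposition labelled by an arbitrary finite type. -/
theorem single {Q : Type} [Fintype Q] (ℓ : Q → Option ι) (N : Q → Matrix X X ℂ)
    (hN : ∀ q, (N q).PosSemidef) (hG : G = ∑ q, N q) (hH : H = ∑ q, phase β (ℓ q) ⊙ N q) :
    GramPath β 1 G H := by
  classical
  refine ⟨fun p => ∑ q, if ℓ q = p then N q else 0, fun p => ?_, ?_, ?_⟩
  · refine Matrix.posSemidef_sum _ fun q _ => ?_
    split_ifs
    exacts [hN q, Matrix.PosSemidef.zero]
  · rw [hG, Finset.sum_comm]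
    simp
  · change queryUpdate β _ = H
    rw [hH]
    simp only [queryUpdate, Matrix.hadamard_sum']
    rw [Finset.sum_comm]
    refine Finset.sum_congr rfl fun q _ => ?_
    rw [Finset.sum_eq_single (ℓ q)] <;> simp +contextual [eq_comm]

theorem refl_succ (hG : G.PosSemidef) : GramPath β 1 G G :=
  single (fun _ : Unit => none) (fun _ => G) (fun _ => hG) (by simp) (by
    ext; simp [phase])

theorem refl (hG : G.PosSemidef) (T : ℕ) : GramPath β T G G := by
  induction T with
  | zero => exact (rfl : G = G)
  | succ T ih => exact ih.trans (refl_succ hG)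

theorem mono (h : GramPath β S G H) (hG : G.PosSemidef) (hST : S ≤ T) : GramPath β T G H := by
  obtain ⟨d, rfl⟩ := Nat.exists_eq_add_of_le hST
  exact h.trans (refl (h.posSemidef hG) d)

/-- Uncomputation: a phase query is its own inverse. -/
theorem symm (h : GramPath β T G H) : GramPath β T H G := by
  induction T generalizing G with
  | zero => exact (show G = H from h).symm
  | succ T ih =>
    obtain ⟨N, hN, rfl, hp⟩ := h
    refine (ih hp).trans (single id (fun q => phase β q ⊙ N q)
      (fun q => (posSemidef_phase β q).hadamard (hN q)) rfl ?_)
    simp [phase_hadamard_phase]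

/-- The Hadamard product is the Gram matrix of tensor products: `M` belongs to a register that the
computation leaves alone. -/
theorem hadamard_left (hM : M.PosSemidef) (h : GramPath β T G H) :
    GramPath β T (M ⊙ G) (M ⊙ H) := by
  induction T generalizing G with
  | zero =>
    obtain rfl : G = H := h
    exact (rfl : M ⊙ G = M ⊙ G)
  | succ T ih =>
    obtain ⟨N, hN, rfl, hp⟩ := h
    refine ⟨fun q => M ⊙ N q, fun q => hM.hadamard (hN q), Matrix.hadamard_sum' _ _, ?_⟩
    rw [queryUpdate_hadamard]
    exact ih hp

/-- A sum is the Gram matrix of a direct sum: different computations run in orthogonal branches and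
share their query slots, so `T` does not grow. -/
theorem sum {Q : Type} [Fintype Q] {G H : Q → Matrix X X ℂ}
    (h : ∀ q, GramPath β T (G q) (H q)) : GramPath β T (∑ q, G q) (∑ q, H q) := by
  induction T generalizing G with
  | zero => exact Finset.sum_congr rfl fun q _ => h q
  | succ T ih =>
    choose N hN hG hp using h
    refine ⟨fun p => ∑ q, N q p, fun p => Matrix.posSemidef_sum _ fun q _ => hN q p, ?_, ?_⟩
    · rw [Finset.sum_comm]
      exact Finset.sum_congr rfl fun q _ => hG q
    · have : queryUpdate β (fun p => ∑ q, N q p) = ∑ q, queryUpdate β (N q) := by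
        simp only [queryUpdate, Matrix.hadamard_sum']
        exact Finset.sum_comm
      rw [this]
      exact ih hp

theorem comap {γ : Y → κ → Bool} {G H : Matrix Y Y ℂ} (φ : X → Y) (ρ : κ → ι)
    (hφ : ∀ x j, β x (ρ j) = γ (φ x) j) (h : GramPath γ T G H) :
    GramPath β T (G.submatrix φ φ) (H.submatrix φ φ) := by
  induction T generalizing G with
  | zero =>
    obtain rfl : G = H := h
    exact (rfl : G.submatrix φ φ = _)
  | succ T ih =>
    obtain ⟨N, hN, rfl, hp⟩ := h
    rw [Nat.add_comm]
    refine (single (Option.map ρ) (fun q => (N q).submatrix φ φ) (fun q => (hN q).submatrix φ)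
      (Matrix.submatrix_sum' _ _) ?_).trans (ih hp)
    rw [queryUpdate, Matrix.submatrix_sum']
    refine Finset.sum_congr rfl fun q _ => ?_
    ext x y
    cases q <;> simp [phase, hφ]

/-- A computation specified on some states acts on all states. This allows the remainder of an exact
computation to be run on a perturbed family alongside the exact one. -/
theorem exists_extending {γ : Y → ι → Bool} (e : X → Y) (he : ∀ x, γ (e x) = β x)
    {G' : Matrix Y Y ℂ} (hG' : G'.PosSemidef) (hG : G'.submatrix e e = G)
    (h : GramPath β T G H) : ∃ H' : Matrix Y Y ℂ, GramPath γ T G' H' ∧ H'.submatrix e e = H := by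
  induction T generalizing G G' with
  | zero =>
    obtain rfl : G = H := h
    exact ⟨G', rfl, hG⟩
  | succ T ih =>
    obtain ⟨N, hN, rfl, hp⟩ := h
    obtain ⟨N', hN', hsum, hsub⟩ := hG'.exists_decomposition_extending e N hN hG
    obtain ⟨H', hp', hH'⟩ := ih (posSemidef_queryUpdate (β := γ) hN') (by
      rw [queryUpdate, queryUpdate, Matrix.submatrix_sum']
      refine Finset.sum_congr rfl fun q _ => ?_
      rw [← hsub]
      ext x y
      cases q <;> simp [phase, he]) hp
    exact ⟨H', ⟨N', hN', hsum.symm, hp'⟩, hH'⟩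

end GramPath

end GramPath

/-! ### Translation between query algorithms and Gram paths. -/

section Conversion

variable {X ι Out : Type} [Fintype X] [Fintype ι] [Fintype Out]

/-- With `T` queries to the inputs `β x` one can obtain a classical outcome `o` such that `P o` is
the Gram matrix of the (subnormalized) states after the outcome `o`; in particular `o` has
probability `P o x x` on the input `x`. -/
def Implements (β : X → ι → Bool) (T : ℕ) (P : Out → Matrix X X ℂ) : Prop :=
  (∀ o, (P o).PosSemidef) ∧ GramPath β T (Matrix.of fun _ _ => 1) (∑ o, P o)

/-- The scalar `1/√2`. -/
noncomputable def invSqrtTwo : ℂ := ((√2)⁻¹ : ℝ)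

theorem star_invSqrtTwo : star invSqrtTwo = invSqrtTwo := Complex.conj_ofReal _

theorem invSqrtTwo_mul_self : invSqrtTwo * invSqrtTwo = 1 / 2 := by
  rw [invSqrtTwo, ← Complex.ofReal_mul, ← mul_inv, Real.mul_self_sqrt (by norm_num)]
  norm_num

/-- In the Hadamard basis of the answer bit the XOR oracle is diagonal: the minus component acquires
the sign of `β x i`, and the plus component is unchanged. -/
theorem gramPath_applyOracle {n : ℕ} {W : Type} [Fintype W] (β : X → Fin n → Bool)
    (ψ : X → QBasis n W → ℂ) :
    GramPath β 1 (vecGram ψ) (vecGram fun x => applyOracle (β x) (ψ x)) := by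
  let c : X → QBasis n W → ℂ := fun x s => match s with
    | (none, b, w) => ψ x (none, b, w)
    | (some i, b, w) => invSqrtTwo * (ψ x (some i, false, w) + boolSign b * ψ x (some i, true, w))
  let ℓ : QBasis n W → Option (Fin n) := fun s => match s with
    | (some i, true, _) => some i
    | _ => none
  refine GramPath.single ℓ
    (fun s => Matrix.vecMulVec (star fun x => c x s) (fun x => c x s))
    (fun s => Matrix.posSemidef_vecMulVec_star_self _) ?_ ?_
  · ext x y
    simp only [vecGram, Matrix.of_apply, Matrix.sum_apply, Matrix.vecMulVec_apply, Pi.star_apply,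
      Fintype.sum_prod_type, Fintype.sum_option, Fintype.sum_bool]
    congr 1
    refine Finset.sum_congr rfl fun i _ => ?_
    rw [← Finset.sum_add_distrib, ← Finset.sum_add_distrib]
    refine Finset.sum_congr rfl fun w _ => ?_
    simp only [c, star_mul', star_add, star_invSqrtTwo, boolSign, if_true,
      Bool.false_eq_true, if_false, star_neg, star_one]
    linear_combination (-2 * (star (ψ x (some i, false, w)) * ψ y (some i, false, w) +
      star (ψ x (some i, true, w)) * ψ y (some i, true, w))) * invSqrtTwo_mul_self
  · ext x y
    simp only [vecGram, Matrix.of_apply, Matrix.sum_apply, Matrix.vecMulVec_apply, Pi.star_apply,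
      Fintype.sum_prod_type, Fintype.sum_option, Fintype.sum_bool, Matrix.hadamard_apply,
      applyOracle]
    congr 1
    · simp [ℓ, phase, oracleMap, c]
    refine Finset.sum_congr rfl fun i _ => ?_
    rw [← Finset.sum_add_distrib, ← Finset.sum_add_distrib]
    refine Finset.sum_congr rfl fun w _ => ?_
    simp only [c, star_mul', star_add, star_invSqrtTwo, star_boolSign, ℓ, phase, oracleMap,
      Matrix.of_apply]
    cases β x i <;> cases β y i <;>
    simp only [Bool.xor_false, Bool.xor_true, Bool.not_true, Bool.not_false, boolSign, if_true,
      Bool.false_eq_true, if_false]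
    · linear_combination (-2 * (star (ψ x (some i, false, w)) * ψ y (some i, false, w) +
        star (ψ x (some i, true, w)) * ψ y (some i, true, w))) * invSqrtTwo_mul_self
    · linear_combination (-2 * (star (ψ x (some i, false, w)) * ψ y (some i, true, w) +
        star (ψ x (some i, true, w)) * ψ y (some i, false, w))) * invSqrtTwo_mul_self
    · linear_combination (-2 * (star (ψ x (some i, false, w)) * ψ y (some i, true, w) +
        star (ψ x (some i, true, w)) * ψ y (some i, false, w))) * invSqrtTwo_mul_self
    · linear_combination (-2 * (star (ψ x (some i, false, w)) * ψ y (some i, false, w) +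
        star (ψ x (some i, true, w)) * ψ y (some i, true, w))) * invSqrtTwo_mul_self

theorem QueryAlgorithm.gramPath_state {n : ℕ} {W : Type} [Fintype W] [DecidableEq W]
    (A : QueryAlgorithm n W Out) (β : X → Fin n → Bool) (t : ℕ) :
    GramPath β t (Matrix.of fun _ _ => 1) (vecGram fun x => A.state (β x) t) := by
  induction t with
  | zero =>
    simp only [QueryAlgorithm.state]
    rw [vecGram_mulVec (A.U 0)]
    change _ = _
    ext x y
    simp only [vecGram, Matrix.of_apply]
    rw [Finset.sum_eq_single A.init] <;> simp +contextual
  | succ t ih =>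
    simp only [QueryAlgorithm.state]
    rw [vecGram_mulVec (A.U (t + 1))]
    exact ih.trans (gramPath_applyOracle β _)

theorem QueryAlgorithm.exists_implements {n : ℕ} {W : Type} [Fintype W] [DecidableEq W]
    (A : QueryAlgorithm n W Out) (β : X → Fin n → Bool) :
    ∃ P : Out → Matrix X X ℂ, Implements β A.queries P ∧
      ∀ x o, P o x x = A.prob (β x) {o} := by
  classical
  refine ⟨fun o => vecGram fun x s => if A.output s = o then A.state (β x) A.queries s else 0,
    ⟨fun o => posSemidef_vecGram _, ?_⟩, fun x o => ?_⟩
  · rw [sum_vecGram_mask]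
    exact A.gramPath_state β _
  · simp only [vecGram, Matrix.of_apply, QueryAlgorithm.prob, Set.mem_singleton_iff]
    push_cast
    refine Finset.sum_congr rfl fun s _ => ?_
    split_ifs
    · exact (Complex.conj_mul' _).trans (by simp)
    · simp

open Classical in
theorem QueryAlgorithm.prob_eq_sum {n : ℕ} {W : Type} [Fintype W] [DecidableEq W]
    (A : QueryAlgorithm n W Out) (x : Fin n → Bool) (E : Set Out) :
    A.prob x E = ∑ o, if o ∈ E then A.prob x {o} else 0 := by
  simp only [QueryAlgorithm.prob, Set.mem_singleton_iff]
  have : ∀ o : Out, (if o ∈ E then ∑ s, if A.output s = o then ‖A.state x A.queries s‖ ^ 2 else 0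
      else 0) = ∑ s, if A.output s = o then
        (if A.output s ∈ E then ‖A.state x A.queries s‖ ^ 2 else 0) else 0 := by
    intro o
    by_cases ho : o ∈ E
    · simp only [ho, if_true]
      refine Finset.sum_congr rfl fun s _ => ?_
      split_ifs with h1 h2 <;> simp_all
    · simp only [ho, if_false]
      refine (Finset.sum_eq_zero fun s _ => ?_).symm
      split_ifs with h1 h2 <;> simp_all
  rw [Finset.sum_congr rfl fun o _ => this o, Finset.sum_comm]
  refine Finset.sum_congr rfl fun s _ => ?_
  simp

/-- The state after `t` queries of the computation with unitaries `U` that starts in `v`. -/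
def runState {n : ℕ} {W : Type} [Fintype W] [DecidableEq W]
    (U : ℕ → Matrix.unitaryGroup (QBasis n W) ℂ) (x : Fin n → Bool) (v : QBasis n W → ℂ) :
    ℕ → QBasis n W → ℂ
  | 0 => (U 0).1.mulVec v
  | t + 1 => (U (t + 1)).1.mulVec (applyOracle x (runState U x v t))

theorem runState_succ {n : ℕ} {W : Type} [Fintype W] [DecidableEq W]
    (U : ℕ → Matrix.unitaryGroup (QBasis n W) ℂ) (x : Fin n → Bool) (v : QBasis n W → ℂ) (t : ℕ) :
    runState U x v (t + 1) =
      runState (fun s => U (s + 1)) x (applyOracle x ((U 0).1.mulVec v)) t := by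
  induction t with
  | zero => rfl
  | succ t ih => rw [runState, ih]; rfl

/-- The work register of the algorithm built from a Gram path. -/
abbrev PathRegister (X Out : Type) : Type := Option (X ⊕ (Out × X))

/-- The measurement of the outcome in the algorithm built from a Gram path. -/
noncomputable def pathOutput [Nonempty Out] {n : ℕ} : QBasis n (PathRegister X Out) → Out
  | (_, _, some (.inr (o, _))) => o
  | _ => Classical.arbitrary Out

/-- Before each query the current family is rotated to a realization of the prescribed
decomposition, and at the end to one with the outcome written in the work register. Equality of Gram
matrices supplies every rotation. -/
theorem exists_unitaries_of_gramPath [Nonempty Out] [DecidableEq X] [DecidableEq Out] {n : ℕ}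
    (β : X → Fin n → Bool)
    {P : Out → Matrix X X ℂ} (hP : ∀ o, (P o).PosSemidef) (T : ℕ) (G : Matrix X X ℂ)
    (h : GramPath β T G (∑ o, P o)) (u : X → QBasis n (PathRegister X Out) → ℂ)
    (hu : vecGram u = G) :
    ∃ U : ℕ → Matrix.unitaryGroup (QBasis n (PathRegister X Out)) ℂ, ∀ x o,
      ∑ s, (if pathOutput s = o then ((‖runState U (β x) (u x) T s‖ ^ 2 : ℝ) : ℂ) else 0) =
        P o x x := by
  induction T generalizing G u with
  | zero =>
    obtain rfl : G = _ := h
    choose p hp using fun o => (hP o).exists_vecGram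
    let v : X → QBasis n (PathRegister X Out) → ℂ := fun x s => match s with
      | (none, false, some (.inr (o, z))) => p o x z
      | _ => 0
    obtain ⟨U, hU⟩ := exists_unitary_of_vecGram_eq u v (by
      rw [hu]
      simp_rw [← hp]
      ext x y
      simp [vecGram, v, Fintype.sum_prod_type, Fintype.sum_option, Matrix.sum_apply])
    refine ⟨fun _ => U, fun x o => ?_⟩
    simp only [runState, hU, ← hp]
    have h1 : ∀ s, (if pathOutput s = o then ((‖v x s‖ ^ 2 : ℝ) : ℂ) else 0) = match s with
      | (none, false, some (.inr (o', z))) => if o' = o then star (p o' x z) * p o' x z else 0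
      | _ => 0 := by
      rintro ⟨_ | i, _ | _, _ | z | ⟨o', z⟩⟩ <;> simp [v, pathOutput, Complex.conj_mul']
    simp only [h1]
    simp [vecGram, Fintype.sum_prod_type, Fintype.sum_option]
  | succ T ih =>
    obtain ⟨N, hN, rfl, hp⟩ := h
    choose p hp' using fun q => (hN q).exists_vecGram
    -- Phase kickback: with the answer bit in the state (|0⟩ − |1⟩)/√2, the XOR oracle multiplies
    -- the branch querying `i` by the sign of `β x i`.
    let v : X → QBasis n (PathRegister X Out) → ℂ := fun x s => match s with
      | (q, b, some (.inl z)) => invSqrtTwo * boolSign b * p q x z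
      | _ => 0
    have hv : vecGram v = ∑ q, N q := by
      simp_rw [← hp']
      ext x y
      simp only [vecGram, v, Fintype.sum_prod_type, Matrix.sum_apply, Matrix.of_apply,
        Fintype.sum_option (α := X ⊕ (Out × X)), Fintype.sum_sum_type, Fintype.sum_bool]
      refine Finset.sum_congr rfl fun q _ => ?_
      simp only [mul_zero, Finset.sum_const_zero, add_zero, zero_add]
      rw [← Finset.sum_add_distrib]
      refine Finset.sum_congr rfl fun z _ => ?_
      simp only [star_mul', star_invSqrtTwo, boolSign, if_true, Bool.false_eq_true, if_false,
        star_neg, star_one]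
      linear_combination (2 * star (p q x z) * p q y z) * invSqrtTwo_mul_self
    have hv' : vecGram (fun x => applyOracle (β x) (v x)) = queryUpdate β N := by
      rw [queryUpdate]
      simp_rw [← hp']
      have h1 : ∀ x s, applyOracle (β x) (v x) s = match s with
        | (none, b, some (.inl z)) => invSqrtTwo * boolSign b * p none x z
        | (some i, b, some (.inl z)) => boolSign (β x i) * (invSqrtTwo * boolSign b * p i x z)
        | _ => 0 := by
        rintro x ⟨_ | i, b, _ | z | ⟨o', z⟩⟩ <;> simp only [applyOracle, oracleMap, v]
        cases b <;> cases β x i <;> simp [boolSign]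
      ext x y
      simp only [vecGram, h1, Fintype.sum_prod_type, Matrix.sum_apply, Matrix.of_apply,
        Fintype.sum_option, Fintype.sum_sum_type, Fintype.sum_bool]
      simp only [mul_zero, Finset.sum_const_zero, add_zero, zero_add, phase,
        Matrix.hadamard_apply, Matrix.of_apply, one_mul]
      congr 1
      · rw [← Finset.sum_add_distrib]
        refine Finset.sum_congr rfl fun z _ => ?_
        simp only [star_mul', star_invSqrtTwo, boolSign, if_true, Bool.false_eq_true, if_false,
          star_neg, star_one]
        linear_combination (2 * star (p none x z) * p none y z) * invSqrtTwo_mul_self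
      · refine Finset.sum_congr rfl fun i _ => ?_
        rw [← Finset.sum_add_distrib, Finset.mul_sum]
        refine Finset.sum_congr rfl fun z _ => ?_
        simp only [star_mul', star_invSqrtTwo, star_boolSign]
        generalize boolSign (β x i) = a
        generalize boolSign (β y i) = b
        simp only [boolSign, if_true, Bool.false_eq_true, if_false]
        linear_combination (2 * a * b * star (p i x z) * p i y z) * invSqrtTwo_mul_self
    obtain ⟨V, hV⟩ := exists_unitary_of_vecGram_eq u v (hu.trans hv.symm)
    obtain ⟨U, hU⟩ := ih _ hp _ hv'
    refine ⟨fun t => Nat.casesOn t V U, fun x o => ?_⟩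
    rw [← hU, runState_succ]
    change ∑ s, (if pathOutput s = o then
      ((‖runState U (β x) (applyOracle (β x) (V.1.mulVec (u x))) T s‖ ^ 2 : ℝ) : ℂ) else 0) = _
    rw [hV]

theorem Implements.exists_queryAlgorithm [Nonempty Out] {n : ℕ} {β : X → Fin n → Bool} {T : ℕ}
    {P : Out → Matrix X X ℂ} (h : Implements β T P) :
    ∃ (W : Type) (_ : Fintype W) (_ : DecidableEq W) (A : QueryAlgorithm n W Out),
      A.queries = T ∧ ∀ x o, A.prob (β x) {o} = (P o x x).re := by
  classical
  let init : QBasis n (PathRegister X Out) := (none, false, none)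
  obtain ⟨U, hU⟩ := exists_unitaries_of_gramPath β h.1 T _ h.2 (fun _ => Pi.single init 1) (by
    ext x y
    simp only [vecGram, Matrix.of_apply]
    rw [Finset.sum_eq_single init] <;> simp +contextual)
  refine ⟨PathRegister X Out, inferInstance, inferInstance,
    { queries := T, init := init, U := U, output := pathOutput }, rfl, fun x o => ?_⟩
  rw [← hU x o]
  have hst : ∀ t, QueryAlgorithm.state
      { queries := T, init := init, U := U, output := pathOutput (Out := Out) } (β x) t =
      runState U (β x) (Pi.single init 1) t := by
    intro t
    induction t with
    | zero => rfl
    | succ t ih => rw [QueryAlgorithm.state, ih]; rfl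
  simp only [QueryAlgorithm.prob, hst, Set.mem_singleton_iff, Complex.re_sum]
  refine Finset.sum_congr rfl fun s _ => ?_
  split_ifs
  · exact (Complex.ofReal_re _).symm
  · rfl

end Conversion

/-! ### Composition, repetition and elementary procedures. -/

section Combinators

variable {X Y ι κ Out Out' : Type} [Fintype X] [Fintype Y] [Fintype ι] [Fintype κ] [Fintype Out]
  [Fintype Out'] {β : X → ι → Bool} {S T : ℕ} {P : Out → Matrix X X ℂ}

theorem Matrix.PosSemidef.ofReal_re_diag {M : Matrix X X ℂ} (hM : M.PosSemidef) (x : X) :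
    ((M x x).re : ℂ) = M x x :=
  (Complex.eq_re_of_ofReal_le (r := 0) (by simpa using hM.diag_nonneg (i := x))).symm

theorem Matrix.PosSemidef.re_diag_nonneg {M : Matrix X X ℂ} (hM : M.PosSemidef) (x : X) :
    0 ≤ (M x x).re :=
  (Complex.le_def.mp (hM.diag_nonneg (i := x))).1

theorem Matrix.PosSemidef.hadamard_diag_re {M : Matrix X X ℂ} (hM : M.PosSemidef)
    (N : Matrix X X ℂ) (x : X) : ((M ⊙ N) x x).re = (M x x).re * (N x x).re := by
  rw [Matrix.hadamard_apply, ← hM.ofReal_re_diag, Complex.re_ofReal_mul, Complex.ofReal_re]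

namespace Implements

theorem re_nonneg (h : Implements β T P) (o : Out) (x : X) : 0 ≤ (P o x x).re :=
  (h.1 o).re_diag_nonneg x

theorem sum_re (h : Implements β T P) (x : X) : ∑ o, (P o x x).re = 1 := by
  have := h.2.apply_eq (x := x) (y := x) rfl
  rw [Matrix.sum_apply] at this
  rw [← Complex.re_sum, this]
  simp

theorem mono (h : Implements β S P) (hST : S ≤ T) : Implements β T P :=
  ⟨h.1, h.2.mono posSemidef_ones hST⟩

theorem comap {γ : Y → κ → Bool} {P : Out → Matrix Y Y ℂ} (h : Implements γ T P) (φ : X → Y)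
    (ρ : κ → ι) (hφ : ∀ x j, β x (ρ j) = γ (φ x) j) :
    Implements β T fun o => (P o).submatrix φ φ := by
  refine ⟨fun o => (h.1 o).submatrix φ, ?_⟩
  rw [← Matrix.submatrix_sum']
  exact h.2.comap φ ρ hφ

/-- Classical postprocessing of the outcome. -/
theorem map [DecidableEq Out'] (h : Implements β T P) (φ : Out → Out') :
    Implements β T fun o' => ∑ o, if φ o = o' then P o else 0 := by
  refine ⟨fun o' => Matrix.posSemidef_sum _ fun o _ => ?_, ?_⟩
  · split_ifs
    exacts [h.1 o, Matrix.PosSemidef.zero]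
  · rw [Finset.sum_comm]
    simpa using h.2

/-- An outcome known in advance. -/
theorem pure [DecidableEq Out] (o₀ : Out) :
    Implements β 0 fun o => if o = o₀ then Matrix.of fun _ _ : X => (1 : ℂ) else 0 := by
  refine ⟨fun o => ?_, ?_⟩
  · dsimp only
    split_ifs
    exacts [posSemidef_ones, Matrix.PosSemidef.zero]
  · change _ = _
    simp

/-- Sequential composition with classical control. -/
theorem bind (h : Implements β S P) {R : Out → Out' → Matrix X X ℂ}
    (h' : ∀ o, Implements β T (R o)) :
    Implements β (S + T) fun p : Out × Out' => P p.1 ⊙ R p.1 p.2 := by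
  refine ⟨fun p => (h.1 p.1).hadamard ((h' p.1).1 p.2), h.2.trans ?_⟩
  have := GramPath.sum fun o => (h' o).2.hadamard_left (h.1 o)
  have h1 : ∀ M : Matrix X X ℂ, M ⊙ (Matrix.of fun _ _ => 1) = M := fun M => by ext; simp
  simpa only [Fintype.sum_prod_type, Matrix.hadamard_sum', h1] using this

/-- Parallel composition of a family of procedures. -/
theorem pi {J : Type} [Fintype J] [DecidableEq J] {t : J → ℕ} {R : J → Out → Matrix X X ℂ}
    (h : ∀ j, Implements β (t j) (R j)) :
    Implements β (∑ j, t j) fun o : J → Out => Matrix.of fun x y => ∏ j, R j (o j) x y := by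
  have hp : ∀ (s : Finset J) (N : J → Matrix X X ℂ), (∀ j, (N j).PosSemidef) →
      (Matrix.of fun x y => ∏ j ∈ s, N j x y).PosSemidef := by
    intro s N hN
    induction s using Finset.induction_on with
    | empty => simpa using posSemidef_ones
    | insert a s ha ih =>
      have := (hN a).hadamard ih
      have he : (Matrix.of fun x y => ∏ j ∈ insert a s, N j x y) =
          N a ⊙ Matrix.of fun x y => ∏ j ∈ s, N j x y := by
        ext x y
        simp [Finset.prod_insert ha]
      rw [he]
      exact this
  refine ⟨fun o => hp _ _ fun j => (h j).1 _, ?_⟩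
  have hsum : ∑ o : J → Out, (Matrix.of fun x y => ∏ j, R j (o j) x y) =
      Matrix.of fun x y => ∏ j, (∑ o, R j o) x y := by
    ext x y
    simp only [Matrix.sum_apply, Matrix.of_apply]
    rw [Finset.prod_univ_sum, Fintype.piFinset_univ]
  rw [hsum]
  generalize (Finset.univ : Finset J) = s
  induction s using Finset.induction_on with
  | empty =>
    change _ = _
    simp
  | insert a s ha ih =>
    rw [Finset.sum_insert ha, add_comm]
    refine ih.trans ?_
    have h1 := (h a).2.hadamard_left
      (hp s (fun j => ∑ o, R j o) fun j => Matrix.posSemidef_sum _ fun o _ => (h j).1 o)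
    convert h1 using 1
    · ext x y
      simp
    · ext x y
      simp [Finset.prod_insert ha, mul_comm]

theorem pi_re {J : Type} [Fintype J] [DecidableEq J] {t : J → ℕ} {R : J → Out → Matrix X X ℂ}
    (h : ∀ j, Implements β (t j) (R j)) (o : J → Out) (x : X) :
    (∏ j, R j (o j) x x).re = ∏ j, (R j (o j) x x).re := by
  rw [← Complex.ofReal_re (∏ j, (R j (o j) x x).re), Complex.ofReal_prod]
  congr 1
  exact Finset.prod_congr rfl fun j _ => (((h j).1 _).ofReal_re_diag x).symm

/-- The majority vote over `m` runs decreases the error exponentially. -/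
theorem exists_majority {P : Bool → Matrix X X ℂ} (h : Implements β T P) {g : X → Bool}
    (hg : ∀ x, 2 / 3 ≤ (P (g x) x x).re) (m : ℕ) :
    ∃ P' : Bool → Matrix X X ℂ, Implements β (m * T) P' ∧
      ∀ x, (P' (!g x) x x).re ≤ (17 / 18) ^ m := by
  have hpi := pi (J := Fin m) fun _ => h
  simp only [Finset.sum_const, Finset.card_univ, Fintype.card_fin, smul_eq_mul] at hpi
  let cnt : (Fin m → Bool) → Bool → ℕ := fun o b => (Finset.univ.filter fun i => o i = b).card
  have hcnt : ∀ o b, cnt o b + cnt o (!b) = m := by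
    intro o b
    have := Finset.card_filter_add_card_filter_not (s := (Finset.univ : Finset (Fin m)))
      (fun i => o i = b)
    simp only [Finset.card_univ, Fintype.card_fin] at this
    rw [← this]
    simp only [cnt, ← Bool.eq_not_iff]
  refine ⟨_, hpi.map (fun o => decide (cnt o false ≤ cnt o true)), fun x => ?_⟩
  -- A Chernoff bound: the product of the weights is at least 1 whenever the wrong votes are not
  -- outnumbered, while each run has expected weight at most 2/3 · 2/3 + 1/3 · 3/2 = 17/18.
  let w : Bool → ℝ := fun b => if b = g x then 2 / 3 else 3 / 2
  have hw : ∀ o, decide (cnt o false ≤ cnt o true) = (!g x) → 1 ≤ ∏ i, w (o i) := by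
    intro o ho
    have hle : cnt o (g x) ≤ cnt o (!g x) := by
      cases hgx : g x <;> simp [hgx] at ho <;> simp <;> omega
    have : ∏ i, w (o i) = (2 / 3) ^ cnt o (g x) * (3 / 2) ^ cnt o (!g x) := by
      simp only [w, Finset.prod_ite, Finset.prod_const, cnt, ← Bool.eq_not_iff]
    rw [this]
    obtain ⟨d, hd⟩ := Nat.exists_eq_add_of_le hle
    rw [hd, pow_add, ← mul_assoc, ← mul_pow]
    norm_num
    exact one_le_pow₀ (by norm_num)
  rw [Matrix.sum_apply, Complex.re_sum]
  calc _ ≤ ∑ o : Fin m → Bool, ∏ i, (fun b => (P b x x).re * w b) (o i) := by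
        refine Finset.sum_le_sum fun o _ => ?_
        have h0 : 0 ≤ ∏ i, (P (o i) x x).re := Finset.prod_nonneg fun i _ => h.re_nonneg _ _
        have hw0 : 0 ≤ ∏ i, w (o i) := Finset.prod_nonneg fun i _ => by
          simp only [w]; split_ifs <;> norm_num
        simp only [Finset.prod_mul_distrib]
        split_ifs with ho
        · rw [Matrix.of_apply, pi_re fun _ => h]
          exact le_mul_of_one_le_right h0 (hw o ho)
        · simpa using mul_nonneg h0 hw0
    _ = (∑ b, (fun b => (P b x x).re * w b) b) ^ m := by
        generalize (fun b => (P b x x).re * w b) = f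
        have : (∑ b, f b) ^ m = ∏ _i : Fin m, ∑ b, f b := by simp
        rw [this, Finset.prod_univ_sum, Fintype.piFinset_univ]
    _ ≤ (17 / 18) ^ m := by
        dsimp only
        have h1 := h.sum_re x
        have h2 := hg x
        have h3 := h.re_nonneg (!g x) x
        have h4 : ∀ u : Bool → ℝ, ∑ b, u b = u (g x) + u (!g x) := by
          intro u; cases g x <;> simp [add_comm]
        rw [h4] at h1 ⊢
        have : w (g x) = 2 / 3 ∧ w (!g x) = 3 / 2 := by simp [w]
        rw [this.1, this.2]
        refine pow_le_pow_left₀ (by positivity) ?_ m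
        linarith

/-- Repeating a procedure that may fail (outcome `none`) until it succeeds, at most `m` times. -/
theorem exists_retry {A : Type} [Fintype A] {P : Option A → Matrix X X ℂ} (h : Implements β T P)
    (m : ℕ) :
    ∃ P' : Option A → Matrix X X ℂ, Implements β (m * T) P' ∧
      (∀ x, (P' none x x).re = (P none x x).re ^ m) ∧
      ∀ x a, P (some a) x x = 0 → P' (some a) x x = 0 := by
  classical
  induction m with
  | zero =>
    refine ⟨_, (pure none).mono (Nat.zero_le _), fun x => ?_, fun x a _ => ?_⟩ <;> simp
  | succ m ih =>
    obtain ⟨P', hP', hnone, hsome⟩ := ih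
    have hb := (hP'.bind fun _ => h).map fun p => p.1.or p.2
    rw [← Nat.succ_mul] at hb
    refine ⟨_, hb, fun x => ?_, fun x a ha => ?_⟩
    · rw [Finset.sum_eq_single (none, none)]
      · simp only [Option.or_none, if_true]
        rw [(hP'.1 none).hadamard_diag_re, hnone, pow_succ]
      · rintro ⟨o, o'⟩ - hne
        cases o <;> cases o' <;> simp_all
      · simp
    · rw [Matrix.sum_apply]
      refine Finset.sum_eq_zero fun p _ => ?_
      obtain ⟨o, o'⟩ := p
      split_ifs with h1
      · cases o with
        | none =>
          obtain rfl : o' = some a := by simpa using h1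
          simp [ha]
        | some b =>
          obtain rfl : b = a := by simpa using h1
          simp [hsome x b ha]
      · rfl

/-- Reading one bit. -/
theorem read (β : X → ι → Bool) (i : ι) : Implements β 1 fun b : Bool =>
    Matrix.of fun x y => if β x i = b ∧ β y i = b then (1 : ℂ) else 0 := by
  refine ⟨fun b => ?_, ?_⟩
  · convert Matrix.posSemidef_vecMulVec_star_self (fun x : X => if β x i = b then (1 : ℂ) else 0)
      using 1
    ext x y
    by_cases hx : β x i = b <;> by_cases hy : β y i = b <;> simp [Matrix.vecMulVec_apply, hx, hy]
  -- Query `i` in equal superposition with no query. Afterwards the overlap of two inputs is half of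
  -- 1 plus the product of their signs: 1 for equal bits and 0 for different ones.
  · refine GramPath.single (fun b : Bool => if b then some i else none)
      (fun _ => (1 / 2 : ℂ) • Matrix.of fun _ _ => (1 : ℂ))
      (fun _ => posSemidef_ones.smul (a := (1 / 2 : ℂ)) (by
        rw [Complex.le_def]; norm_num)) ?_ ?_
    · ext x y
      norm_num
    · ext x y
      cases hx : β x i <;> cases hy : β y i <;>
        norm_num [Matrix.add_apply, hx, hy, phase, boolSign]

end Implements

end Combinators

/-! ### Simulating queries by bounded-error subroutines. -/

section Coherent

variable {X ι κ Out : Type} [Fintype X] [Fintype ι] [Fintype κ] [Fintype Out]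

/-- The squared distance between the two vectors with index `x` in a pair of families of vectors
with joint Gram matrix `K`. -/
def pairGap (K : Matrix (X ⊕ X) (X ⊕ X) ℂ) (x : X) : ℝ :=
  (K (.inl x) (.inl x) + K (.inr x) (.inr x) - 2 * K (.inl x) (.inr x)).re

theorem pairGap_sum {Q : Type} [Fintype Q] (K : Q → Matrix (X ⊕ X) (X ⊕ X) ℂ) (x : X) :
    pairGap (∑ q, K q) x = ∑ q, pairGap (K q) x := by
  simp only [pairGap, Matrix.sum_apply, Finset.mul_sum, ← Finset.sum_add_distrib,
    ← Finset.sum_sub_distrib, Complex.re_sum]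

/-- The reverse triangle inequality for the two vectors, by Cauchy–Schwarz. -/
theorem sq_sqrt_sub_sqrt_le_pairGap {K : Matrix (X ⊕ X) (X ⊕ X) ℂ} (hK : K.PosSemidef) (x : X) :
    (√(K (.inl x) (.inl x)).re - √(K (.inr x) (.inr x)).re) ^ 2 ≤ pairGap K x := by
  obtain ⟨u, rfl⟩ := hK.exists_vecGram
  let v : X ⊕ X → EuclideanSpace ℂ (X ⊕ X) := fun a => WithLp.toLp 2 (u a)
  have hin : ∀ a b, vecGram u a b = inner ℂ (v a) (v b) := by
    intro a b
    simp [vecGram, v, PiLp.inner_apply, mul_comm]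
  have hnorm : ∀ a, (vecGram u a a).re = ‖v a‖ ^ 2 := by
    intro a
    rw [hin, inner_self_eq_norm_sq_to_K]
    norm_cast
  have h := re_inner_le_norm (𝕜 := ℂ) (v (.inl x)) (v (.inr x))
  have h1 : pairGap (vecGram u) x = ‖v (.inl x)‖ ^ 2 + ‖v (.inr x)‖ ^ 2 -
      2 * RCLike.re (inner ℂ (v (.inl x)) (v (.inr x))) := by
    rw [pairGap, Complex.sub_re, Complex.add_re, hnorm, hnorm, hin]
    norm_num
  rw [h1, hnorm, hnorm, Real.sqrt_sq (norm_nonneg _), Real.sqrt_sq (norm_nonneg _)]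
  nlinarith

/-- Forgetting which of the two families an index refers to. -/
def foldSum : X ⊕ X → X := Sum.elim id id

/-- Given procedures that compute the bits `γ x i` from the bits `β x` with error `ε`, a query to
`γ` can be replaced by queries to `β`, up to an error in the state: compute the bit, flip the sign
of the state according to the bit, and uncompute. -/
theorem exists_simulated_query {β : X → κ → Bool} {γ : X → ι → Bool} {t : ℕ}
    {P : ι → Bool → Matrix X X ℂ} (hP : ∀ i, Implements β t (P i)) {ε : ℝ}
    (herr : ∀ i x, (P i (!γ x i) x x).re ≤ ε) {N : Option ι → Matrix X X ℂ}
    (hN : ∀ q, (N q).PosSemidef) (hN1 : ∀ x, (∑ q, N q) x x = 1) (hε : 0 ≤ ε) :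
    ∃ K : Matrix (X ⊕ X) (X ⊕ X) ℂ, K.PosSemidef ∧
      GramPath β (2 * t) (∑ q, N q) (K.submatrix .inl .inl) ∧
      K.submatrix .inr .inr = queryUpdate γ N ∧ ∀ x, pairGap K x ≤ 4 * ε := by
  -- The left family is the actual simulation, with the sign of the computed bit `b`; the right
  -- family is the ideal one, with the sign of the true bit.
  let c : ι → Bool → X ⊕ X → ℂ := fun i b =>
    Sum.elim (fun _ => boolSign b) (fun x => boolSign (γ x i))
  let L : Option ι → Matrix (X ⊕ X) (X ⊕ X) ℂ := fun q => match q with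
    | none => Matrix.of fun _ _ => 1
    | some i => ∑ b, (P i b).submatrix foldSum foldSum ⊙
        Matrix.vecMulVec (star (c i b)) (c i b)
  have hL : ∀ q, (L q).PosSemidef := by
    rintro (_ | i)
    · exact posSemidef_ones
    · exact Matrix.posSemidef_sum _ fun b _ => (((hP i).1 b).submatrix _).hadamard
        (Matrix.posSemidef_vecMulVec_star_self _)
  let F : Option ι → Matrix X X ℂ := fun q => match q with
    | none => Matrix.of fun _ _ => 1
    | some i => ∑ b, P i b
  have hF : ∀ q, GramPath β t (Matrix.of fun _ _ => 1) (F q) := by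
    rintro (_ | i)
    · exact GramPath.refl posSemidef_ones t
    · exact (hP i).2
  have hones : ∀ M : Matrix X X ℂ, M ⊙ (Matrix.of fun _ _ => 1) = M := fun M => by ext; simp
  let K₀ : Matrix (X ⊕ X) (X ⊕ X) ℂ := ∑ q, (N q).submatrix foldSum foldSum ⊙ L q
  have hK₀ : K₀.PosSemidef :=
    Matrix.posSemidef_sum _ fun q _ => ((hN q).submatrix _).hadamard (hL q)
  have hl : K₀.submatrix .inl .inl = ∑ q, N q ⊙ F q := by
    rw [Matrix.submatrix_sum']
    refine Finset.sum_congr rfl fun q _ => ?_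
    ext x y
    cases q with
    | none => simp [L, F, foldSum]
    | some i => simp [L, F, foldSum, c, Matrix.vecMulVec_apply, boolSign]
  have hr : K₀.submatrix .inr .inr = ∑ q, (phase γ q ⊙ N q) ⊙ F q := by
    rw [Matrix.submatrix_sum']
    refine Finset.sum_congr rfl fun q _ => ?_
    ext x y
    cases q with
    | none => simp [L, F, foldSum, phase]
    | some i =>
      simp only [L, F, foldSum, c, Matrix.vecMulVec_apply, phase, Matrix.submatrix_apply,
        Matrix.hadamard_apply, Fintype.sum_bool, Matrix.add_apply, Sum.elim_inr, id,
        Pi.star_apply, star_boolSign, Matrix.of_apply]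
      ring
  have h₁ : GramPath β t (∑ q, N q) (K₀.submatrix .inl .inl) := by
    rw [hl]
    simpa only [hones] using GramPath.sum fun q => (hF q).hadamard_left (hN q)
  -- In the ideal family the sign does not depend on the computed bit, so reversing the computation
  -- erases the workspace exactly. The same reversal is then extended to the actual family.
  have h₂ : GramPath β t (K₀.submatrix .inr .inr) (queryUpdate γ N) := by
    rw [hr, queryUpdate]
    simpa only [hones] using (GramPath.sum fun q => (hF q).hadamard_left
      ((posSemidef_phase γ q).hadamard (hN q))).symm
  obtain ⟨K, hpath, hK⟩ := h₂.exists_extending (γ := β ∘ foldSum) Sum.inr (fun _ => rfl) hK₀ rfl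
  refine ⟨K, hpath.posSemidef hK₀, ?_, hK, fun x => ?_⟩
  · rw [two_mul]
    exact h₁.trans (hpath.comap Sum.inl id fun _ _ => rfl)
  · have h3 : pairGap K x = pairGap K₀ x := by
      simp only [pairGap]
      rw [hpath.apply_eq (x := .inl x) (y := .inl x) rfl,
        hpath.apply_eq (x := .inr x) (y := .inr x) rfl,
        hpath.apply_eq (x := .inl x) (y := .inr x) rfl]
    -- The families differ only where the computed bit is wrong, and there by a sign: squared
    -- distance 4 times the error probability.
    have h4 : ∀ q, pairGap ((N q).submatrix foldSum foldSum ⊙ L q) x ≤ (N q x x).re * (4 * ε) := by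
      rintro (_ | i)
      · have : pairGap ((N none).submatrix foldSum foldSum ⊙ L none) x = 0 := by
          simp only [pairGap, L, foldSum, Matrix.hadamard_apply, Matrix.submatrix_apply,
            Sum.elim_inl, Sum.elim_inr, Matrix.of_apply, id]
          ring_nf
          simp
        rw [this]
        exact mul_nonneg ((hN _).re_diag_nonneg x) (by positivity)
      · have : pairGap ((N (some i)).submatrix foldSum foldSum ⊙ L (some i)) x =
            (N (some i) x x).re * (4 * (P i (!γ x i) x x).re) := by
          have h5 : pairGap ((N (some i)).submatrix foldSum foldSum ⊙ L (some i)) x =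
              (N (some i) x x * (4 * P i (!γ x i) x x)).re := by
            simp only [pairGap, L, foldSum, Matrix.hadamard_apply, Matrix.submatrix_apply,
              Sum.elim_inl, Sum.elim_inr, id, Fintype.sum_bool, Matrix.add_apply,
              Matrix.vecMulVec_apply, Pi.star_apply, c, star_boolSign]
            congr 1
            cases γ x i <;> simp only [boolSign, Bool.false_eq_true, if_true, if_false,
              Bool.not_true, Bool.not_false] <;> ring
          rw [h5, ← (hN _).ofReal_re_diag, Complex.re_ofReal_mul, Complex.ofReal_re]
          norm_num
        rw [this]
        exact mul_le_mul_of_nonneg_left (by linarith [herr i x]) ((hN _).re_diag_nonneg x)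
    rw [h3, pairGap_sum]
    refine (Finset.sum_le_sum fun q _ => h4 q).trans ?_
    rw [← Finset.sum_mul, ← Complex.re_sum, ← Matrix.sum_apply, hN1]
    simp

/-- Coherent composition: replacing all queries to `γ` by simulated ones. -/
theorem GramPath.exists_simulation [Nonempty Out] {β : X → κ → Bool} {γ : X → ι → Bool} {t : ℕ}
    {P : ι → Bool → Matrix X X ℂ} (hP : ∀ i, Implements β t (P i)) {ε : ℝ}
    (herr : ∀ i x, (P i (!γ x i) x x).re ≤ ε) (hε : 0 ≤ ε) {T : ℕ} {G : Matrix X X ℂ}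
    (hG1 : ∀ x, G x x = 1) {Q : Out → Matrix X X ℂ}
    (hQ : ∀ o, (Q o).PosSemidef) (h : GramPath γ T G (∑ o, Q o)) :
    ∃ Q' : Out → Matrix X X ℂ, (∀ o, (Q' o).PosSemidef) ∧
      GramPath β (2 * t * T) G (∑ o, Q' o) ∧
      ∀ o x, |√(Q' o x x).re - √(Q o x x).re| ≤ T * (2 * √ε) := by
  induction T generalizing G Q with
  | zero =>
    obtain rfl : G = _ := h
    exact ⟨Q, hQ, rfl, fun o x => by simp⟩
  | succ T ih =>
    obtain ⟨N, hN, rfl, hp⟩ := h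
    obtain ⟨K, hK, hpath, hKr, hgap⟩ := exists_simulated_query hP herr hN hG1 hε
    -- Hybrid argument: the remaining exact queries act on the actual and ideal states together and
    -- keep their distance, so one replacement shifts outcome amplitudes by at most 2√ε. The
    -- induction hypothesis then replaces the remaining queries, starting from the actual state.
    obtain ⟨K₂, hp₂, hK₂⟩ := hp.exists_extending (γ := γ ∘ foldSum) Sum.inr (fun _ => rfl) hK hKr
    obtain ⟨R, hR, hRsum, hRQ⟩ := (hp₂.posSemidef hK).exists_decomposition_extending Sum.inr Q hQ hK₂
    have hp₃ : GramPath γ T (K.submatrix .inl .inl) (∑ o, (R o).submatrix .inl .inl) := by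
      rw [← Matrix.submatrix_sum', hRsum]
      exact hp₂.comap Sum.inl id fun _ _ => rfl
    obtain ⟨Q', hQ', hp', hclose⟩ := ih (fun x => by rw [hpath.apply_eq rfl, hG1])
      (fun o => (hR o).submatrix _) hp₃
    refine ⟨Q', hQ', ?_, fun o x => ?_⟩
    · rw [Nat.mul_succ, add_comm]
      exact hpath.trans hp'
    · have h1 : pairGap (R o) x ≤ 4 * ε := by
        have h2 : pairGap K₂ x = pairGap K x := by
          simp only [pairGap]
          rw [hp₂.apply_eq (x := .inl x) (y := .inl x) rfl,
            hp₂.apply_eq (x := .inr x) (y := .inr x) rfl,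
            hp₂.apply_eq (x := .inl x) (y := .inr x) rfl]
        rw [← hRsum, pairGap_sum] at h2
        refine le_trans ?_ (h2.trans_le (hgap x))
        exact Finset.single_le_sum (f := fun o => pairGap (R o) x)
          (fun o _ => (sq_nonneg _).trans (sq_sqrt_sub_sqrt_le_pairGap (hR o) x))
          (Finset.mem_univ o)
      have h3 := (sq_sqrt_sub_sqrt_le_pairGap (hR o) x).trans h1
      have h4 : (4 * ε) = (2 * √ε) ^ 2 := by
        rw [mul_pow, Real.sq_sqrt hε]; norm_num
      rw [h4] at h3
      have h5 := abs_le_of_sq_le_sq h3 (by positivity)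
      have h6 : R o (.inr x) (.inr x) = Q o x x := by rw [← hRQ]; rfl
      rw [h6] at h5
      have h7 := hclose o x
      simp only [Matrix.submatrix_apply] at h7
      have h8 : |√(R o (.inl x) (.inl x)).re - √(Q o x x).re| ≤ 2 * √ε := h5
      calc |√(Q' o x x).re - √(Q o x x).re|
          ≤ |√(Q' o x x).re - √(R o (.inl x) (.inl x)).re| +
            |√(R o (.inl x) (.inl x)).re - √(Q o x x).re| := abs_sub_le _ _ _
        _ ≤ T * (2 * √ε) + 2 * √ε := add_le_add h7 h8
        _ = ((T + 1 : ℕ) : ℝ) * (2 * √ε) := by push_cast; ring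

end Coherent

/-! ### Probabilities after classical postprocessing. -/

section Postprocessing

variable {X ι Out Out' : Type} [Fintype X] [Fintype ι] [Fintype Out] [Fintype Out']
  [DecidableEq Out'] {β : X → ι → Bool} {T : ℕ} {P : Out → Matrix X X ℂ}

theorem Implements.le_map_re (h : Implements β T P) (φ : Out → Out') (o : Out) (x : X) :
    (P o x x).re ≤ ((∑ o', if φ o' = φ o then P o' else 0) x x).re := by
  rw [Matrix.sum_apply, Complex.re_sum]
  have h0 : ∀ o', 0 ≤ ((if φ o' = φ o then P o' else 0) x x).re := by
    intro o'
    split_ifs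
    exacts [h.re_nonneg _ _, le_rfl]
  refine le_trans ?_ (Finset.single_le_sum (fun o' _ => h0 o') (Finset.mem_univ o))
  simp

theorem exists_of_map_ne_zero (φ : Out → Out') {o' : Out'} {x : X}
    (h : (∑ o, if φ o = o' then P o else 0) x x ≠ 0) : ∃ o, φ o = o' ∧ P o x x ≠ 0 := by
  rw [Matrix.sum_apply] at h
  obtain ⟨o, -, ho⟩ := Finset.exists_ne_zero_of_sum_ne_zero h
  by_cases h1 : φ o = o'
  · exact ⟨o, h1, by simpa [h1] using ho⟩
  · rw [if_neg h1] at ho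
    exact absurd rfl ho

end Postprocessing

/-! ### Complexity measures in terms of Gram paths. -/

namespace PartialBoolFun

/-- The inputs in the domain of `f`. -/
abbrev Inputs (f : PartialBoolFun) : Type := {x // x ∈ f.Dom}

noncomputable instance (f : PartialBoolFun) : Fintype f.Inputs := Fintype.ofFinite _

/-- The bits of an input. -/
abbrev bits (f : PartialBoolFun) (x : f.Inputs) : Fin f.arity → Bool := x.1

/-- The value of `f` on an input in its domain. -/
def val (f : PartialBoolFun) (x : f.Inputs) : Bool := (f.toFun x.1).get x.2

theorem toFun_eq_some_val (f : PartialBoolFun) (x : f.Inputs) : f.toFun x.1 = some (f.val x) :=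
  (Option.some_get x.2).symm

end PartialBoolFun

open PartialBoolFun

section Functions

variable {f g : PartialBoolFun}

/-- Reading all bits of the input. -/
theorem exists_implements_read_all (f : PartialBoolFun) :
    ∃ P : (Fin f.arity → Bool) → Matrix f.Inputs f.Inputs ℂ, Implements f.bits f.arity P ∧
      (∀ x : f.Inputs, P x.1 x x = 1) ∧ ∀ x o, P o x x ≠ 0 → o = x.1 := by
  have h := Implements.pi fun i : Fin f.arity => Implements.read f.bits i
  simp only [Finset.sum_const, Finset.card_univ, Fintype.card_fin, smul_eq_mul, mul_one] at h
  refine ⟨_, h, fun x => by simp, fun x o ho => ?_⟩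
  rw [Matrix.of_apply, Finset.prod_ne_zero_iff] at ho
  ext i
  have := ho i (Finset.mem_univ i)
  by_contra hne
  simp [Ne.symm hne] at this

theorem quantumComplexity_le_of_implements {T : ℕ} {P : Bool → Matrix f.Inputs f.Inputs ℂ}
    (h : Implements f.bits T P) (hP : ∀ x, 2 / 3 ≤ (P (f.val x) x x).re) :
    quantumComplexity f ≤ T := by
  obtain ⟨W, i1, i2, A, rfl, hA⟩ := h.exists_queryAlgorithm
  refine Nat.sInf_le ⟨W, i1, i2, A, fun x hx => ?_, rfl⟩
  have : {b | f.toFun x = some b} = {f.val ⟨x, hx⟩} := by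
    ext b
    rw [toFun_eq_some_val f ⟨x, hx⟩]
    simp [eq_comm]
  rw [this]
  exact (hP ⟨x, hx⟩).trans_eq (hA ⟨x, hx⟩ _).symm

theorem QueryAlgorithm.Computes.exists_implements {W : Type} [Fintype W] [DecidableEq W]
    {A : QueryAlgorithm f.arity W Bool} (hA : A.Computes (f := f)) :
    ∃ P : Bool → Matrix f.Inputs f.Inputs ℂ, Implements f.bits A.queries P ∧
      ∀ x, 2 / 3 ≤ (P (f.val x) x x).re := by
  obtain ⟨P, hP, hprob⟩ := A.exists_implements f.bits
  refine ⟨P, hP, fun x => ?_⟩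
  have : {b | f.toFun x.1 = some b} = {f.val x} := by
    ext b
    rw [toFun_eq_some_val f x]
    simp [eq_comm]
  rw [hprob, Complex.ofReal_re, ← this]
  exact hA x.1 x.2

theorem exists_implements_val_of_read (f : PartialBoolFun) :
    ∃ P : Bool → Matrix f.Inputs f.Inputs ℂ, Implements f.bits f.arity P ∧
      ∀ x, 2 / 3 ≤ (P (f.val x) x x).re := by
  obtain ⟨P, hP, h1, -⟩ := exists_implements_read_all f
  refine ⟨_, hP.map fun o => (f.toFun o).getD false, fun x => ?_⟩
  have h := hP.le_map_re (fun o => (f.toFun o).getD false) x.1 x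
  rw [h1] at h
  simp only [toFun_eq_some_val f x, Option.getD_some] at h
  norm_num at h
  linarith

theorem quantumComplexity_le_arity (f : PartialBoolFun) : quantumComplexity f ≤ f.arity := by
  obtain ⟨P, hP, h1⟩ := exists_implements_val_of_read f
  exact quantumComplexity_le_of_implements hP h1

theorem exists_implements_quantumComplexity (f : PartialBoolFun) :
    ∃ P : Bool → Matrix f.Inputs f.Inputs ℂ, Implements f.bits (quantumComplexity f) P ∧
      ∀ x, 2 / 3 ≤ (P (f.val x) x x).re := by
  have hne : {T | ∃ (W : Type) (_ : Fintype W) (_ : DecidableEq W)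
      (A : QueryAlgorithm f.arity W Bool), A.Computes (f := f) ∧ T = A.queries}.Nonempty := by
    obtain ⟨P, hP, h1⟩ := exists_implements_val_of_read f
    obtain ⟨W, i1, i2, A, -, hA⟩ := hP.exists_queryAlgorithm
    refine ⟨_, W, i1, i2, A, fun x hx => ?_, rfl⟩
    have : {b | f.toFun x = some b} = {f.val ⟨x, hx⟩} := by
      ext b
      rw [toFun_eq_some_val f ⟨x, hx⟩]
      simp [eq_comm]
    rw [this]
    exact (h1 ⟨x, hx⟩).trans_eq (hA ⟨x, hx⟩ _).symm
  obtain ⟨W, i1, i2, A, hA, hT⟩ := Nat.sInf_mem hne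
  obtain ⟨P, hP, h1⟩ := hA.exists_implements
  refine ⟨P, ?_, h1⟩
  rw [quantumComplexity, hT]
  exact hP

/-- The outcome matrices `P` describe a procedure that finds certificates of size at most `s`. -/
def IsCertFinder (f : PartialBoolFun) (s : ℕ)
    (P : Option (PartialAssignment f.arity) → Matrix f.Inputs f.Inputs ℂ) : Prop :=
  ∀ x, (P none x x).re ≤ 1 / 2 ∧
    ∀ p, P (some p) x x ≠ 0 → IsCertificate f x.1 p ∧ p.size ≤ s

theorem exists_findsCertificate {T s : ℕ}
    {P : Option (PartialAssignment f.arity) → Matrix f.Inputs f.Inputs ℂ}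
    (h : Implements f.bits T P) (hP : IsCertFinder f s P) :
    ∃ (W : Type) (_ : Fintype W) (_ : DecidableEq W)
      (A : QueryAlgorithm f.arity W (Option (PartialAssignment f.arity))),
      A.queries = T ∧ A.FindsCertificate (f := f) s := by
  classical
  obtain ⟨W, i1, i2, A, hT, hA⟩ := h.exists_queryAlgorithm
  refine ⟨W, i1, i2, A, hT, fun x hx => ?_⟩
  obtain ⟨h1, h2⟩ := hP ⟨x, hx⟩
  have hA' : ∀ o, A.prob x {o} = (P o ⟨x, hx⟩ ⟨x, hx⟩).re := hA ⟨x, hx⟩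
  refine ⟨?_, fun p hp => h2 p fun h0 => hp ?_⟩
  · have hs := h.sum_re ⟨x, hx⟩
    rw [Fintype.sum_option] at hs
    rw [A.prob_eq_sum, Fintype.sum_option, if_neg (by simp), zero_add]
    have h3 : (1 : ℝ) / 2 ≤ ∑ p, (P (some p) ⟨x, hx⟩ ⟨x, hx⟩).re := by linarith
    refine h3.trans (Finset.sum_le_sum fun p _ => ?_)
    rw [hA']
    by_cases hp : P (some p) ⟨x, hx⟩ ⟨x, hx⟩ = 0
    · simp [hp]
    · rw [if_pos ⟨p, rfl, (h2 p hp).1⟩]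
  · rw [hA', h0, Complex.zero_re]

theorem certQuantumComplexity_le_of_implements {T s : ℕ}
    {P : Option (PartialAssignment f.arity) → Matrix f.Inputs f.Inputs ℂ}
    (h : Implements f.bits T P) (hP : IsCertFinder f s P) :
    certQuantumComplexity f ≤ T + s := by
  obtain ⟨W, i1, i2, A, rfl, hA⟩ := exists_findsCertificate h hP
  exact Nat.sInf_le ⟨W, i1, i2, A, s, hA, rfl⟩

theorem PartialAssignment.size_le {n : ℕ} (p : PartialAssignment n) : p.size ≤ n :=
  (Finset.card_le_univ _).trans_eq (Fintype.card_fin n)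

theorem isCertificate_full (f : PartialBoolFun) (x : Fin f.arity → Bool) :
    IsCertificate f x fun i => some (x i) := by
  refine ⟨fun i b h => by simpa using h, fun y _ hy => ?_⟩
  have : y = x := funext fun i => hy i _ rfl
  rw [this]

theorem exists_isCertFinder_read (f : PartialBoolFun) :
    ∃ P, Implements f.bits f.arity P ∧ IsCertFinder f f.arity P := by
  classical
  obtain ⟨P, hP, -, h2⟩ := exists_implements_read_all f
  refine ⟨_, hP.map fun o => some fun i => some (o i), fun x => ⟨?_, fun p hp => ?_⟩⟩
  · simp
  · obtain ⟨o, ho, hne⟩ := exists_of_map_ne_zero _ hp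
    obtain rfl := h2 x o hne
    obtain rfl := Option.some.inj ho
    exact ⟨isCertificate_full f x.1, PartialAssignment.size_le _⟩

theorem exists_isCertFinder (f : PartialBoolFun) :
    ∃ T s P, T + s = certQuantumComplexity f ∧ Implements f.bits T P ∧ IsCertFinder f s P := by
  classical
  have hne : {c | ∃ (W : Type) (_ : Fintype W) (_ : DecidableEq W)
      (A : QueryAlgorithm f.arity W (Option (PartialAssignment f.arity))) (s : ℕ),
      A.FindsCertificate (f := f) s ∧ c = A.queries + s}.Nonempty := by
    obtain ⟨P, hP, h1⟩ := exists_isCertFinder_read f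
    obtain ⟨W, i1, i2, A, hT, hA⟩ := exists_findsCertificate hP h1
    exact ⟨_, W, i1, i2, A, _, hA, rfl⟩
  obtain ⟨W, i1, i2, A, s, hA, hT⟩ := Nat.sInf_mem hne
  obtain ⟨P, hP, hprob⟩ := A.exists_implements f.bits
  refine ⟨A.queries, s, P, hT.symm, hP, fun x => ⟨?_, fun p hp => ?_⟩⟩
  · obtain ⟨h1, h2⟩ := hA x.1 x.2
    rw [A.prob_eq_sum, Fintype.sum_option, if_neg (by simp), zero_add] at h1
    have hs := hP.sum_re x
    rw [Fintype.sum_option] at hs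
    have h3 : (1 : ℝ) / 2 ≤ ∑ p, (P (some p) x x).re := by
      refine h1.trans (Finset.sum_le_sum fun p _ => ?_)
      split_ifs
      · rw [hprob, Complex.ofReal_re]
      · exact hP.re_nonneg _ _
    linarith
  · refine (hA x.1 x.2).2 p fun h0 => hp ?_
    rw [hprob, h0, Complex.ofReal_zero]

end Functions

/-! ### Block composition and quantum query complexity. -/

namespace PartialBoolFun

variable {f g : PartialBoolFun}

/-- The `i`-th block of a string for `f.comp g`. -/
def compBlock (f g : PartialBoolFun) (x : Fin (f.comp g).arity → Bool) (i : Fin f.arity) :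
    Fin g.arity → Bool :=
  block (n := f.arity) (m := g.arity) x i

theorem compBlock_apply (x : Fin (f.comp g).arity → Bool) (i : Fin f.arity) (j : Fin g.arity) :
    compBlock f g x i j = x (finProdFinEquiv (i, j) : Fin (f.arity * g.arity)) := rfl

theorem compBlock_mem {x : Fin (f.comp g).arity → Bool} (hx : x ∈ (f.comp g).Dom)
    (i : Fin f.arity) : compBlock f g x i ∈ g.Dom := by
  by_contra hi
  have h : ¬ ∀ i : Fin f.arity, (g.toFun (block (n := f.arity) (m := g.arity) x i)).isSome :=
    fun h => hi (h i)
  have : (f.comp g).toFun x = none := dif_neg h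
  simp [Dom, this] at hx

/-- The `i`-th block of an input of `f.comp g`. -/
def blockInput (x : (f.comp g).Inputs) (i : Fin f.arity) : g.Inputs :=
  ⟨compBlock f g x.1 i, compBlock_mem x.2 i⟩

theorem toFun_comp (x : (f.comp g).Inputs) :
    (f.comp g).toFun x.1 = f.toFun fun i => g.val (blockInput x i) :=
  dif_pos fun i => compBlock_mem x.2 i

/-- The input of `f` that arises from an input of `f.comp g`. -/
def outerInput (x : (f.comp g).Inputs) : f.Inputs :=
  ⟨fun i => g.val (blockInput x i), by
    have h : ((f.comp g).toFun x.1).isSome := x.2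
    rw [toFun_comp] at h
    exact h⟩

theorem val_comp (x : (f.comp g).Inputs) : (f.comp g).val x = f.val (outerInput x) := by
  have h := toFun_comp x
  rw [toFun_eq_some_val] at h
  exact Option.some.inj (h.trans (toFun_eq_some_val f (outerInput x)))

end PartialBoolFun

theorem Implements.comap_blockInput {f g : PartialBoolFun} {Out : Type} [Fintype Out] {T : ℕ}
    {P : Out → Matrix g.Inputs g.Inputs ℂ} (h : Implements g.bits T P) (i : Fin f.arity) :
    Implements (f.comp g).bits T fun o =>
      (P o).submatrix (fun x => blockInput x i) fun x => blockInput x i :=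
  h.comap (fun x => blockInput x i) (fun j => (finProdFinEquiv (i, j) : Fin (f.arity * g.arity)))
    fun _ _ => rfl

/-- Composition of bounded-error algorithms, with `m` runs of the inner algorithm for each bit that
the outer algorithm needs. -/
theorem quantumComplexity_comp_le (f g : PartialBoolFun) (m : ℕ)
    (hm : (30 * quantumComplexity f : ℝ) ^ 2 * (17 / 18) ^ m ≤ 1 / 625) :
    quantumComplexity (f.comp g) ≤ 2 * (m * quantumComplexity g) * (30 * quantumComplexity f) := by
  obtain ⟨P, hP, hP1⟩ := exists_implements_quantumComplexity f
  obtain ⟨R, hR, hR1⟩ := exists_implements_quantumComplexity g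
  -- Thirty runs bring the outer error below 19/100, hence the correct amplitude to at least 9/10.
  -- By `hm` the simulation costs at most 8/100 of it, and (82/100)² exceeds 2/3.
  obtain ⟨P', hP', hP1'⟩ := hP.exists_majority hP1 30
  obtain ⟨R', hR', hR1'⟩ := hR.exists_majority hR1 m
  have hout := hP'.comap (β := fun x : (f.comp g).Inputs => (outerInput x).1) outerInput id
    fun _ _ => rfl
  obtain ⟨Q', hQ', hpath, hclose⟩ := hout.2.exists_simulation (ε := (17 / 18) ^ m)
    (fun i => hR'.comap_blockInput (f := f) i) (fun i x => hR1' (blockInput x i)) (by positivity)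
    (fun x => rfl) hout.1
  refine quantumComplexity_le_of_implements ⟨hQ', hpath⟩ fun x => ?_
  have h1 := hclose ((f.comp g).val x) x
  simp only [Matrix.submatrix_apply, val_comp] at h1 ⊢
  have h2 : 81 / 100 ≤ (P' (f.val (outerInput x)) (outerInput x) (outerInput x)).re := by
    have h3 := hP1' (outerInput x)
    have h4 := hP'.sum_re (outerInput x)
    have h5 : ((17 : ℝ) / 18) ^ 30 ≤ 19 / 100 := by norm_num
    rw [Fintype.sum_bool] at h4
    cases hv : f.val (outerInput x) <;> simp only [hv, Bool.not_true, Bool.not_false] at h3 ⊢ <;>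
      linarith
  have h3 : (9 / 10 : ℝ) ≤ √(P' (f.val (outerInput x)) (outerInput x) (outerInput x)).re :=
    Real.le_sqrt_of_sq_le (by linarith)
  have h4 : ((30 * quantumComplexity f : ℕ) : ℝ) * (2 * √((17 / 18) ^ m)) ≤ 8 / 100 := by
    refine abs_le_of_sq_le_sq' ?_ (by norm_num) |>.2
    rw [mul_pow, mul_pow, Real.sq_sqrt (by positivity)]
    push_cast
    linarith
  have h5 := (abs_le.mp h1).1
  set q := (Q' (f.val (outerInput x)) x x).re
  have h6 : 82 / 100 ≤ √q := by linarith
  have h7 : 0 ≤ q := (hQ' _).re_diag_nonneg x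
  have h8 := Real.sq_sqrt h7
  nlinarith

/-! ### Certificates of compositions and the lower bounds on Q_C. -/

section Certificates

variable {f g : PartialBoolFun}

theorem exists_certificate_certAt (f : PartialBoolFun) (x : Fin f.arity → Bool) :
    ∃ p, IsCertificate f x p ∧ p.size = certAt f x :=
  Nat.sInf_mem (s := {s | ∃ p, IsCertificate f x p ∧ p.size = s})
    ⟨_, _, isCertificate_full f x, rfl⟩

theorem exists_certificate_size_le {x : Fin f.arity → Bool} (hx : x ∈ f.Dom) :
    ∃ p, IsCertificate f x p ∧ p.size ≤ certComplexity f := by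
  classical
  obtain ⟨p, hp, hs⟩ := exists_certificate_certAt f x
  refine ⟨p, hp, hs.trans_le ?_⟩
  exact Finset.le_sup (f := certAt f) (Finset.mem_filter.mpr ⟨Finset.mem_univ _, hx⟩)

theorem certComplexity_le {s : ℕ} (h : ∀ x ∈ f.Dom, ∃ p, IsCertificate f x p ∧ p.size ≤ s) :
    certComplexity f ≤ s := by
  classical
  refine Finset.sup_le fun x hx => ?_
  obtain ⟨p, hp, hs⟩ := h x (Finset.mem_filter.mp hx).2
  exact (Nat.sInf_le ⟨p, hp, rfl⟩ : certAt f x ≤ p.size).trans hs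

/-- The partial assignment for `f.comp g` that consists of the assignments `r i` to the blocks `i`
that are revealed by `p`. -/
def PartialAssignment.combine (p : PartialAssignment f.arity)
    (r : Fin f.arity → PartialAssignment g.arity) : PartialAssignment (f.comp g).arity :=
  fun k =>
    let ij := finProdFinEquiv.symm (k : Fin (f.arity * g.arity))
    if (p ij.1).isSome then r ij.1 ij.2 else none

theorem PartialAssignment.combine_apply (p : PartialAssignment f.arity)
    (r : Fin f.arity → PartialAssignment g.arity) (i : Fin f.arity) (j : Fin g.arity) :
    p.combine r (finProdFinEquiv (i, j) : Fin (f.arity * g.arity)) =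
      if (p i).isSome then r i j else none := by
  unfold PartialAssignment.combine
  dsimp only
  rw [Equiv.symm_apply_apply]

theorem PartialAssignment.combine_sub_iff {p : PartialAssignment f.arity}
    {r : Fin f.arity → PartialAssignment g.arity} {x : Fin (f.comp g).arity → Bool} :
    (p.combine r).Sub x ↔ ∀ i, (p i).isSome → (r i).Sub (compBlock f g x i) := by
  constructor
  · intro h i hi j b hb
    refine h _ b ?_
    rw [combine_apply, if_pos hi, hb]
  · intro h k b hb
    obtain ⟨⟨i, j⟩, rfl⟩ := finProdFinEquiv.surjective (k : Fin (f.arity * g.arity))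
    rw [combine_apply] at hb
    split_ifs at hb with hi
    exact h i hi j b hb

theorem PartialAssignment.size_combine_le {p : PartialAssignment f.arity}
    {r : Fin f.arity → PartialAssignment g.arity} {s : ℕ}
    (h : ∀ i, (p i).isSome → (r i).size ≤ s) : (p.combine r).size ≤ p.size * s := by
  classical
  refine le_trans (Finset.card_le_card ?_) (Finset.card_biUnion_le_card_mul
    (Finset.univ.filter fun i => (p i).isSome)
    (fun i => (Finset.univ.filter fun j => (r i j).isSome).image
      fun j => (finProdFinEquiv (i, j) : Fin (f.arity * g.arity))) s fun i hi => ?_)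
  · intro k hk
    obtain ⟨⟨i, j⟩, rfl⟩ := finProdFinEquiv.surjective (k : Fin (f.arity * g.arity))
    replace hk := (Finset.mem_filter.mp hk).2
    rw [combine_apply] at hk
    split_ifs at hk with hi
    · refine Finset.mem_biUnion.mpr ⟨i, by simpa using hi, Finset.mem_image.mpr ⟨j, ?_, rfl⟩⟩
      simpa using hk
    · simp at hk
  · exact Finset.card_image_le.trans (h i (by simpa using hi))

/-- An input consistent with the combination has the same `g`-values as `x` on the blocks revealed
by `p`, so its outer string is consistent with `p`. -/
theorem isCertificate_combine {x : (f.comp g).Inputs} {p : PartialAssignment f.arity}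
    {r : Fin f.arity → PartialAssignment g.arity} (hp : IsCertificate f (outerInput x).1 p)
    (hr : ∀ i, (p i).isSome → IsCertificate g (blockInput x i).1 (r i)) :
    IsCertificate (f.comp g) x.1 (p.combine r) := by
  refine ⟨PartialAssignment.combine_sub_iff.mpr fun i hi => (hr i hi).1, fun y hy hsub => ?_⟩
  rw [PartialAssignment.combine_sub_iff] at hsub
  have h1 := toFun_comp (⟨y, hy⟩ : (f.comp g).Inputs)
  have h2 := toFun_comp x
  rw [h2, show (f.comp g).toFun y = _ from h1]
  refine hp.2 _ (outerInput (⟨y, hy⟩ : (f.comp g).Inputs)).2 fun i b hb => ?_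
  have hi : (p i).isSome := by simp [hb]
  have h3 := (hr i hi).2 _ (compBlock_mem hy i) (hsub i hi)
  have h4 : g.val (blockInput (⟨y, hy⟩ : (f.comp g).Inputs) i) = g.val (blockInput x i) := by
    have h5 := toFun_eq_some_val g (blockInput (⟨y, hy⟩ : (f.comp g).Inputs) i)
    have h6 := toFun_eq_some_val g (blockInput x i)
    exact Option.some.inj (h5.symm.trans (Eq.trans h3 h6))
  change g.val (blockInput (⟨y, hy⟩ : (f.comp g).Inputs) i) = b
  rw [h4]
  exact hp.1 i b hb

theorem certComplexity_comp_le (f g : PartialBoolFun) :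
    certComplexity (f.comp g) ≤ certComplexity f * certComplexity g := by
  refine certComplexity_le fun x hx => ?_
  let x' : (f.comp g).Inputs := ⟨x, hx⟩
  obtain ⟨p, hp, hps⟩ := exists_certificate_size_le (outerInput x').2
  choose r hr hrs using fun i => exists_certificate_size_le (blockInput x' i).2
  exact ⟨p.combine r, isCertificate_combine (x := x') hp fun i _ => hr i,
    (PartialAssignment.size_combine_le fun i _ => hrs i).trans (Nat.mul_le_mul_right _ hps)⟩

/-- An algorithm that succeeds with positive probability has some certificate within its size bound
as a possible output. -/
theorem certComplexity_le_certQuantumComplexity (f : PartialBoolFun) :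
    certComplexity f ≤ certQuantumComplexity f := by
  obtain ⟨T, s, P, hT, hP, hf⟩ := exists_isCertFinder f
  refine certComplexity_le fun x hx => ?_
  obtain ⟨h1, h2⟩ := hf ⟨x, hx⟩
  have hs := hP.sum_re ⟨x, hx⟩
  rw [Fintype.sum_option] at hs
  obtain ⟨p, -, hp⟩ := Finset.exists_ne_zero_of_sum_ne_zero
    (s := Finset.univ) (f := fun p => (P (some p) ⟨x, hx⟩ ⟨x, hx⟩).re) (by linarith)
  obtain ⟨h3, h4⟩ := h2 p fun h0 => hp (by rw [h0, Complex.zero_re])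
  exact ⟨p, h3, by omega⟩

/-- A certificate determines the value, and two attempts both fail with probability at most 1/4,
which is less than 1/3. -/
theorem quantumComplexity_le_certQuantumComplexity (f : PartialBoolFun) :
    quantumComplexity f ≤ 2 * certQuantumComplexity f := by
  classical
  obtain ⟨T, s, P, hT, hP, hf⟩ := exists_isCertFinder f
  obtain ⟨P', hP', hnone, hsome⟩ := hP.exists_retry 2
  let φ : Option (PartialAssignment f.arity) → Bool := fun o =>
    decide (∃ p, o = some p ∧ ∃ y ∈ f.Dom, p.Sub y ∧ f.toFun y = some true)
  refine (quantumComplexity_le_of_implements (hP'.map φ) fun x => ?_).trans (by omega)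
  have h1 : ∑ p, (P' (some p) x x).re ≤
      ((∑ o, if φ o = f.val x then P' o else 0) x x).re := by
    rw [Matrix.sum_apply, Complex.re_sum, Fintype.sum_option]
    refine le_add_of_nonneg_of_le ?_ (Finset.sum_le_sum fun p _ => ?_)
    · split_ifs
      exacts [hP'.re_nonneg _ _, le_rfl]
    · by_cases hp : P (some p) x x = 0
      · rw [hsome x p hp]
        split_ifs
        exacts [hP'.re_nonneg _ _, le_rfl]
      · obtain ⟨⟨hsub, hcert⟩, -⟩ := (hf x).2 p hp
        have : φ (some p) = f.val x := by
          rw [toFun_eq_some_val] at hcert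
          simp only [φ, Option.some.injEq]
          cases hv : f.val x
          · rw [hv] at hcert
            refine decide_eq_false ?_
            rintro ⟨p', rfl, y, hy, hs, ht⟩
            rw [hcert y hy hs] at ht
            simp at ht
          · rw [hv] at hcert
            exact decide_eq_true ⟨p, rfl, x.1, x.2, hsub, hcert _ x.2 hsub⟩
        rw [if_pos this]
  have hs := hP'.sum_re x
  rw [Fintype.sum_option, hnone] at hs
  have h2 : (P none x x).re ^ 2 ≤ (1 / 2) ^ 2 :=
    pow_le_pow_left₀ (hP.re_nonneg _ _) (hf x).1 2
  linarith

end Certificates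

/-! ### Finding certificates of a composition. -/

section CertComposition

variable {f g : PartialBoolFun}

theorem Implements.map_re_le {X ι Out Out' : Type} [Fintype X] [Fintype ι] [Fintype Out]
    [Fintype Out'] [DecidableEq Out'] {β : X → ι → Bool} {T : ℕ} {P : Out → Matrix X X ℂ}
    (h : Implements β T P) (φ : Out → Out') (o' : Out') (x : X) (e : Out → ℝ)
    (he1 : ∀ o, e o ≤ 1) (he0 : ∀ o, φ o = o' → e o = 0) :
    ((∑ o, if φ o = o' then P o else 0) x x).re ≤ 1 - ∑ o, e o * (P o x x).re := by
  rw [Matrix.sum_apply, Complex.re_sum, ← h.sum_re x, ← Finset.sum_sub_distrib]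
  refine Finset.sum_le_sum fun o _ => ?_
  split_ifs with ho
  · rw [he0 o ho]
    simp
  · have := mul_le_mul_of_nonneg_right (he1 o) (h.re_nonneg o x)
    change 0 ≤ _
    linarith

/-- Bernoulli's inequality; it takes the place of a union bound over independent blocks. -/
theorem three_quarters_le_prod {n : ℕ} {δ : ℝ} (hδ : δ ≤ 1) (hn : n * δ ≤ 1 / 4) (a : Fin n → ℝ)
    (ha : ∀ i, 1 - δ ≤ a i) : 3 / 4 ≤ ∏ i, a i := by
  have h1 := one_add_mul_le_pow (show (-2 : ℝ) ≤ -δ by linarith) n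
  have h2 : (1 - δ) ^ n ≤ ∏ i, a i := by
    have := Finset.prod_le_prod (s := Finset.univ) (f := fun _ : Fin n => 1 - δ) (g := a)
      (fun i _ => by linarith) fun i _ => ha i
    simpa using this
  rw [← sub_eq_add_neg] at h1
  linarith

open Classical in
/-- The final step of the certificate search: combine the certificates of the blocks. -/
noncomputable def combineOutcome (f g : PartialBoolFun)
    (p : (Fin f.arity → Bool) → PartialAssignment f.arity)
    (o : (Fin f.arity → Bool) × (Fin f.arity → Option (PartialAssignment g.arity))) :
    Option (PartialAssignment (f.comp g).arity) :=
  let q : PartialAssignment (f.comp g).arity :=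
    (p o.1).combine fun i => (o.2 i).getD fun _ => none
  -- The second test needs no further queries: it checks that the value is constant on the domain
  -- inputs consistent with `q`. Wrong block values therefore cause failure at worst, never a false
  -- certificate.
  if (∀ i, (p o.1 i).isSome → (o.2 i).isSome) ∧
      ∀ y ∈ (f.comp g).Dom, ∀ z ∈ (f.comp g).Dom, q.Sub y → q.Sub z →
        (f.comp g).toFun y = (f.comp g).toFun z
  then some q else none

/-- To find a certificate for `f.comp g`, compute the values of all blocks, choose a certificate of
`f` for these values, and find certificates of `g` for the blocks that it reveals. -/
theorem certQuantumComplexity_comp_le (f g : PartialBoolFun) {m k : ℕ} (hk : 0 < k)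
    (hm : (f.arity : ℝ) * (17 / 18) ^ m ≤ 1 / 4) (hk' : (f.arity : ℝ) * (1 / 2) ^ k ≤ 1 / 4) :
    certQuantumComplexity (f.comp g) ≤
      f.arity * (m * quantumComplexity g) + certComplexity f * (k * certQuantumComplexity g) := by
  classical
  obtain ⟨R, hR, hR1⟩ := exists_implements_quantumComplexity g
  obtain ⟨R', hR', hR1'⟩ := hR.exists_majority hR1 m
  obtain ⟨T, s, B, hTs, hB, hBf⟩ := exists_isCertFinder g
  obtain ⟨B', hB', hBnone, hBsome⟩ := hB.exists_retry k
  -- The computed string may be wrong and even lie outside the domain; the empty assignment then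
  -- keeps the size bound.
  have hp : ∀ y, ∃ p : PartialAssignment f.arity, p.size ≤ certComplexity f ∧
      (y ∈ f.Dom → IsCertificate f y p) := by
    intro y
    by_cases hy : y ∈ f.Dom
    · obtain ⟨p, h1, h2⟩ := exists_certificate_size_le hy
      exact ⟨p, h2, fun _ => h1⟩
    · exact ⟨fun _ => none, by simp [PartialAssignment.size], fun h => absurd h hy⟩
  choose p hps hpc using hp
  -- Blocks not revealed by `p y` return `none` without a query, so at most `certComplexity f`
  -- blocks are searched.
  let S : (Fin f.arity → Bool) → Fin f.arity → Option (PartialAssignment g.arity) →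
      Matrix (f.comp g).Inputs (f.comp g).Inputs ℂ := fun y i o =>
    if (p y i).isSome then (B' o).submatrix (fun x => blockInput x i) fun x => blockInput x i
    else if o = none then Matrix.of fun _ _ => 1 else 0
  have hS : ∀ y i, Implements (f.comp g).bits (if (p y i).isSome then k * T else 0) (S y i) := by
    intro y i
    by_cases hi : (p y i).isSome
    · simp only [S, hi, if_true]
      exact hB'.comap_blockInput i
    · simp only [S, hi]
      exact Implements.pure none
  have hvalues := Implements.pi fun i : Fin f.arity => hR'.comap_blockInput (f := f) i
  simp only [Finset.sum_const, Finset.card_univ, Fintype.card_fin, smul_eq_mul] at hvalues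
  have hsearch : ∀ y, Implements (f.comp g).bits (certComplexity f * (k * T))
      (fun o : Fin f.arity → Option (PartialAssignment g.arity) =>
        Matrix.of fun x x' => ∏ i, S y i (o i) x x') := by
    intro y
    refine (Implements.pi (hS y)).mono ?_
    rw [← Finset.sum_filter, Finset.sum_const, smul_eq_mul]
    exact Nat.mul_le_mul_right _ (hps y)
  have hall := hvalues.bind hsearch
  have hSsome : ∀ y i r (x : (f.comp g).Inputs), (p y i).isSome → S y i (some r) x x ≠ 0 →
      IsCertificate g (blockInput x i).1 r ∧ r.size ≤ s := by
    intro y i r x hi hne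
    simp only [S, hi, if_true] at hne
    exact (hBf (blockInput x i)).2 r fun h0 => hne (hBsome _ _ h0)
  refine (certQuantumComplexity_le_of_implements (s := certComplexity f * s)
    (hall.map (combineOutcome f g p)) fun x => ⟨?_, fun q hq => ?_⟩).trans ?_
  · have hδ : (1 / 2 : ℝ) ^ k ≤ 1 := pow_le_one₀ (by norm_num) (by norm_num)
    have hε : (17 / 18 : ℝ) ^ m ≤ 1 := pow_le_one₀ (by norm_num) (by norm_num)
    let y₀ : Fin f.arity → Bool := (outerInput x).1
    -- The indicator that block `i` causes no failure. Correct block values and successful searches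
    -- each have probability at least 3/4, and 9/16 exceeds 1/2.
    let e : Fin f.arity → Option (PartialAssignment g.arity) → ℝ := fun i o =>
      if (p y₀ i).isSome → ∃ r, o = some r ∧ IsCertificate g (blockInput x i).1 r then 1 else 0
    have he0 : ∀ i o, 0 ≤ e i o := fun i o => by simp only [e]; split_ifs <;> norm_num
    have he1 : ∀ i o, e i o ≤ 1 := fun i o => by simp only [e]; split_ifs <;> norm_num
    have hle := hall.map_re_le (combineOutcome f g p) none x
      (fun o => (if o.1 = y₀ then 1 else 0) * ∏ i, e i (o.2 i)) (fun o => ?_) (fun o ho => ?_)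
    · refine hle.trans ?_
      have hval : (3 / 4 : ℝ) ≤ ∏ i, (R' (y₀ i) (blockInput x i) (blockInput x i)).re := by
        refine three_quarters_le_prod hε hm _ fun i => ?_
        have h1 := hR1' (blockInput x i)
        have h2 := hR'.sum_re (blockInput x i)
        rw [Fintype.sum_bool] at h2
        change _ ≤ (R' (g.val (blockInput x i)) _ _).re
        cases hv : g.val (blockInput x i) <;>
          simp only [hv, Bool.not_true, Bool.not_false] at h1 <;> linarith
      have hser : (3 / 4 : ℝ) ≤ ∏ i, ∑ o, e i o * (S y₀ i o x x).re := by
        refine three_quarters_le_prod hδ hk' _ fun i => ?_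
        by_cases hi : (p y₀ i).isSome
        · have h1 := (hS y₀ i).sum_re x
          rw [Fintype.sum_option] at h1 ⊢
          have h2 : (S y₀ i none x x).re ≤ (1 / 2) ^ k := by
            simp only [S, hi, if_true, Matrix.submatrix_apply, hBnone]
            exact pow_le_pow_left₀ (hB.re_nonneg _ _) (hBf _).1 k
          have h3 : ∀ r, e i (some r) * (S y₀ i (some r) x x).re = (S y₀ i (some r) x x).re := by
            intro r
            by_cases hne : S y₀ i (some r) x x = 0
            · rw [hne]; simp
            · have : e i (some r) = 1 :=
                if_pos fun _ => ⟨r, rfl, (hSsome _ _ _ _ hi hne).1⟩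
              rw [this, one_mul]
          simp only [h3]
          have h4 := mul_nonneg (he0 i none) ((hS y₀ i).re_nonneg none x)
          linarith
        · have h1 := (hS y₀ i).sum_re x
          have h2 : ∀ o, e i o = 1 := fun o => if_pos fun h => absurd h hi
          simp only [h2, one_mul, h1]
          have : (0 : ℝ) ≤ (1 / 2) ^ k := by positivity
          linarith
      have htot : ∑ o : (Fin f.arity → Bool) × (Fin f.arity → Option (PartialAssignment g.arity)),
          ((if o.1 = y₀ then 1 else 0) * ∏ i, e i (o.2 i)) *
            (((Matrix.of fun x x' => ∏ i, (R' (o.1 i)).submatrix (fun x => blockInput x i)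
                (fun x => blockInput x i) x x') ⊙
              (Matrix.of fun x x' => ∏ i, S o.1 i (o.2 i) x x')) x x).re =
          (∏ i, (R' (y₀ i) (blockInput x i) (blockInput x i)).re) *
            ∏ i, ∑ o, e i o * (S y₀ i o x x).re := by
        rw [Fintype.sum_prod_type, Finset.sum_eq_single y₀]
        · rw [Finset.prod_univ_sum, Fintype.piFinset_univ, Finset.mul_sum]
          refine Finset.sum_congr rfl fun o _ => ?_
          rw [(hvalues.1 y₀).hadamard_diag_re]
          simp only [Matrix.of_apply]
          rw [Implements.pi_re (hS y₀),
            Implements.pi_re fun i : Fin f.arity => hR'.comap_blockInput (f := f) i,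
            Finset.prod_mul_distrib]
          simp only [if_true, one_mul, Matrix.submatrix_apply]
          ring
        · intro y _ hy
          simp [hy]
        · simp
      rw [htot]
      have := mul_le_mul hval hser (by norm_num) (le_trans (by norm_num) hval)
      linarith
    · refine mul_le_one₀ (by split_ifs <;> norm_num) (Finset.prod_nonneg fun i _ => he0 i _)
        (Finset.prod_le_one (fun i _ => he0 i _) fun i _ => he1 i _)
    · by_contra hne
      obtain ⟨y, o⟩ := o
      rw [← ne_eq, mul_ne_zero_iff, Finset.prod_ne_zero_iff] at hne
      obtain rfl : y = y₀ := by
        by_contra h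
        exact hne.1 (if_neg h)
      have h1 : ∀ i, (p y₀ i).isSome → ∃ r, o i = some r ∧
          IsCertificate g (blockInput x i).1 r := by
        intro i
        by_contra h
        exact hne.2 i (Finset.mem_univ i) (if_neg h)
      have h2 : IsCertificate (f.comp g) x.1 ((p y₀).combine fun i => (o i).getD fun _ => none) := by
        refine isCertificate_combine (hpc y₀ (outerInput x).2) fun i hi => ?_
        obtain ⟨r, hr, hc⟩ := h1 i hi
        rw [hr]
        exact hc
      rw [combineOutcome, if_pos] at ho
      · simp at ho
      · refine ⟨fun i hi => ?_, fun y hy z hz hsy hsz => ?_⟩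
        · obtain ⟨r, hr, -⟩ := h1 i hi
          simp [hr]
        · rw [h2.2 y hy hsy, h2.2 z hz hsz]
  · obtain ⟨⟨y, o⟩, ho, hne⟩ := exists_of_map_ne_zero _ hq
    rw [combineOutcome] at ho
    dsimp only at ho
    split_ifs at ho with hc
    obtain rfl := Option.some.inj ho
    rw [Matrix.hadamard_apply] at hne
    have hne2 := right_ne_zero_of_mul hne
    rw [Matrix.of_apply, Finset.prod_ne_zero_iff] at hne2
    have h1 : ∀ i, (p y i).isSome →
        IsCertificate g (blockInput x i).1 ((o i).getD fun _ => none) ∧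
          ((o i).getD fun _ => none).size ≤ s := by
      intro i hi
      obtain ⟨r, hr⟩ := Option.isSome_iff_exists.mp (hc.1 i hi)
      have h3 := hne2 i (Finset.mem_univ i)
      simp only [hr] at h3
      rw [hr]
      exact hSsome y i r x hi h3
    -- Whatever `y` was computed, the block certificates found agree with `x`; together with the
    -- constancy test this makes the combination a certificate for `x`.
    have hsub : ((p y).combine fun i => (o i).getD fun _ => none).Sub x.1 :=
      PartialAssignment.combine_sub_iff.mpr fun i hi => (h1 i hi).1.1
    exact ⟨⟨hsub, fun z hz hsz => hc.2 z hz x.1 x.2 hsz hsub⟩,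
      (PartialAssignment.size_combine_le fun i hi => (h1 i hi).2).trans
        (Nat.mul_le_mul_right _ (hps y))⟩
  · rw [← hTs, add_assoc, mul_add, mul_add]
    have := Nat.mul_le_mul_left (certComplexity f) (Nat.le_mul_of_pos_left s hk)
    omega

end CertComposition

/-! ### Associativity of composition and the powers of f. -/

namespace PartialBoolFun

theorem eq_of_cast {f g : PartialBoolFun} (h : f.arity = g.arity)
    (h' : ∀ x : Fin g.arity → Bool, f.toFun (fun i => x (Fin.cast h i)) = g.toFun x) : f = g := by
  obtain ⟨n, F⟩ := f
  obtain ⟨m, G⟩ := g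
  dsimp only at h
  subst h
  congr 1
  funext x
  exact h' x

/-- A relational form of composition that avoids the dependent `Option.get`, so that associativity
can be checked on witnesses. -/
theorem comp_toFun_eq_some_iff {f g : PartialBoolFun} {x : Fin (f.comp g).arity → Bool} {b : Bool} :
    (f.comp g).toFun x = some b ↔
      ∃ y, (∀ i, g.toFun (compBlock f g x i) = some (y i)) ∧ f.toFun y = some b := by
  constructor
  · intro h
    have hx : x ∈ (f.comp g).Dom := by simp [Dom, h]
    exact ⟨_, fun i => toFun_eq_some_val g (blockInput (⟨x, hx⟩ : (f.comp g).Inputs) i),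
      (toFun_comp (⟨x, hx⟩ : (f.comp g).Inputs)).symm.trans h⟩
  · rintro ⟨y, hy, hb⟩
    have h : ∀ i, (g.toFun (compBlock f g x i)).isSome := fun i => by simp [hy]
    refine (dif_pos h).trans (Eq.trans ?_ hb)
    congr 1
    funext i
    exact Option.get_of_eq_some _ (hy i)

theorem comp_assoc (f g h : PartialBoolFun) : (f.comp g).comp h = f.comp (g.comp h) := by
  have harity : ((f.comp g).comp h).arity = (f.comp (g.comp h)).arity :=
    Nat.mul_assoc f.arity g.arity h.arity
  refine eq_of_cast harity fun x => ?_
  have hblock : ∀ (i : Fin f.arity) (j : Fin g.arity),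
      compBlock (f.comp g) h (fun k => x (Fin.cast harity k))
        (finProdFinEquiv (i, j) : Fin (f.arity * g.arity)) =
      compBlock g h (compBlock f (g.comp h) x i) j := by
    intro i j
    funext k
    simp only [compBlock_apply]
    refine congrArg x (Fin.ext ?_)
    change k.val + h.arity * (j.val + g.arity * i.val) =
      k.val + h.arity * j.val + g.arity * h.arity * i.val
    rw [Nat.mul_add, ← Nat.add_assoc, ← Nat.mul_assoc, Nat.mul_comm h.arity g.arity]
  refine Option.ext fun b => ?_
  rw [comp_toFun_eq_some_iff, comp_toFun_eq_some_iff]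
  constructor
  · rintro ⟨y, hy, hb⟩
    obtain ⟨z, hz, hb⟩ := comp_toFun_eq_some_iff.mp hb
    refine ⟨z, fun i => comp_toFun_eq_some_iff.mpr ⟨compBlock f g y i, fun j => ?_, hz i⟩, hb⟩
    rw [← hblock]
    exact hy _
  · rintro ⟨z, hz, hb⟩
    choose w hw hw' using fun i => comp_toFun_eq_some_iff.mp (hz i)
    let y : Fin (f.arity * g.arity) → Bool := fun k =>
      w (finProdFinEquiv.symm k).1 (finProdFinEquiv.symm k).2
    have hy : ∀ i j, y (finProdFinEquiv (i, j)) = w i j := fun i j => by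
      simp only [y, Equiv.symm_apply_apply]
    refine ⟨y, fun k => ?_, comp_toFun_eq_some_iff.mpr ⟨z, fun i => ?_, hb⟩⟩
    · obtain ⟨⟨i, j⟩, rfl⟩ := finProdFinEquiv.surjective (k : Fin (f.arity * g.arity))
      exact (congrArg h.toFun (hblock i j)).trans ((hw i j).trans (congrArg some (hy i j).symm))
    · rw [← hw' i]
      exact congrArg g.toFun (funext fun j => hy i j)

theorem id₁_comp (g : PartialBoolFun) : id₁.comp g = g := by
  have harity : (id₁.comp g).arity = g.arity := Nat.one_mul _
  refine eq_of_cast harity fun x => ?_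
  have hblock : ∀ i, compBlock id₁ g (fun k => x (Fin.cast harity k)) i = x := by
    intro i
    have hi : i.val = 0 := Nat.lt_one_iff.mp i.isLt
    funext k
    refine congrArg x (Fin.ext ?_)
    change k.val + g.arity * i.val = k.val
    rw [hi, Nat.mul_zero, Nat.add_zero]
  refine Option.ext fun b => ?_
  rw [comp_toFun_eq_some_iff]
  constructor
  · rintro ⟨y, hy, hb⟩
    have h := hy (⟨0, Nat.one_pos⟩ : Fin 1)
    exact (congrArg g.toFun (hblock _)).symm.trans (h.trans hb)
  · intro h
    exact ⟨fun _ => b, fun i => (congrArg g.toFun (hblock i)).trans h, rfl⟩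

theorem iter_add (f : PartialBoolFun) (j k : ℕ) :
    f.iter (j + k) = (f.iter j).comp (f.iter k) := by
  induction j with
  | zero => rw [Nat.zero_add, iter, id₁_comp]
  | succ j ih => rw [Nat.add_right_comm, iter, ih, iter, comp_assoc]

theorem arity_iter (f : PartialBoolFun) (k : ℕ) : (f.iter k).arity = f.arity ^ k := by
  induction k with
  | zero => rfl
  | succ k ih =>
    change f.arity * (f.iter k).arity = _
    rw [ih, pow_succ']

end PartialBoolFun

/-! ### Recurrences along the powers of f. -/

theorem arity_iter_le (f : PartialBoolFun) (j : ℕ) :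
    ((f.iter j).arity : ℝ) ≤ ((f.arity : ℝ) + 1) ^ j := by
  rw [arity_iter]
  push_cast
  exact pow_le_pow_left₀ (by positivity) (by linarith) j

/-- Up to a factor that is linear in `j`, quantum query complexity is submultiplicative on the
powers of `f`. -/
theorem exists_quantumComplexity_iter_add_le (f : PartialBoolFun) :
    ∃ D : ℕ, 0 < D ∧ ∀ j k, 0 < j → quantumComplexity (f.iter (j + k)) ≤
      D * j * quantumComplexity (f.iter j) * quantumComplexity (f.iter k) := by
  set N : ℝ := (f.arity : ℝ) + 1
  have hN : 0 < N := by positivity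
  -- With `m * j` runs the inner error is at most (750 N)^(-2j), which beats the squared outer query
  -- count (30 N^j)²; and 30/750 = 1/25 gives the required 1/625.
  obtain ⟨m, hm⟩ := exists_pow_lt_of_lt_one (x := 1 / (750 * N) ^ 2) (y := (17 / 18 : ℝ))
    (by positivity) (by norm_num)
  refine ⟨60 * m + 1, by omega, fun j k hj => ?_⟩
  rw [iter_add]
  refine (quantumComplexity_comp_le (f.iter j) (f.iter k) (m * j) ?_).trans ?_
  · have hQ : (quantumComplexity (f.iter j) : ℝ) ≤ N ^ j :=
      le_trans (by exact_mod_cast quantumComplexity_le_arity _) (arity_iter_le f j)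
    have h1 : (17 / 18 : ℝ) ^ (m * j) ≤ (1 / (750 * N) ^ 2) ^ j := by
      rw [pow_mul]
      exact pow_le_pow_left₀ (by positivity) hm.le j
    have h2 : (30 * (quantumComplexity (f.iter j) : ℝ)) ^ 2 ≤ (30 * N ^ j) ^ 2 :=
      pow_le_pow_left₀ (by positivity) (by linarith) 2
    have h3 : (1 / (750 : ℝ) ^ 2) ^ j ≤ 1 / 750 ^ 2 :=
      pow_le_of_le_one (by positivity) (by norm_num) hj.ne'
    calc _ ≤ (30 * N ^ j) ^ 2 * (1 / (750 * N) ^ 2) ^ j := mul_le_mul h2 h1 (by positivity)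
          (by positivity)
      _ = 900 * (1 / (750 : ℝ) ^ 2) ^ j * ((N ^ 2 * (1 / N ^ 2)) ^ j) := by
          have : 1 / (750 * N) ^ 2 = 1 / 750 ^ 2 * (1 / N ^ 2) := by
            rw [mul_pow, one_div_mul_one_div]
          rw [this, mul_pow, mul_pow (N ^ 2)]
          generalize 1 / N ^ 2 = a
          generalize (1 : ℝ) / 750 ^ 2 = b
          ring_nf
      _ ≤ 900 * (1 / 750 ^ 2) * 1 := by
          rw [mul_one_div_cancel (by positivity), one_pow]
          linarith
      _ = 1 / 625 := by norm_num
  · have : 2 * (m * j * quantumComplexity (f.iter k)) * (30 * quantumComplexity (f.iter j)) =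
        60 * m * (j * quantumComplexity (f.iter j) * quantumComplexity (f.iter k)) := by ring
    rw [this, mul_assoc (60 * m + 1), mul_assoc (60 * m + 1)]
    exact Nat.mul_le_mul_right _ (Nat.le_succ _)

theorem certComplexity_iter_add_le (f : PartialBoolFun) (j k : ℕ) :
    certComplexity (f.iter (j + k)) ≤ certComplexity (f.iter j) * certComplexity (f.iter k) := by
  rw [iter_add]
  exact certComplexity_comp_le _ _

/-- The order of quantifiers matters: `E` may depend on `j` arbitrarily but not on `k`, while the
coefficient of Q_C may exceed C(f^j) only by a factor whose j-th root tends to 1. Linearly many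
retries suffice because the arity of f^j is exponential in `j`. -/
theorem exists_certQuantumComplexity_iter_add_le (f : PartialBoolFun) :
    ∃ D : ℕ, 0 < D ∧ ∀ j, 0 < j → ∃ E : ℕ, ∀ k, certQuantumComplexity (f.iter (j + k)) ≤
      E * quantumComplexity (f.iter k) +
        D * j * certComplexity (f.iter j) * certQuantumComplexity (f.iter k) := by
  set N : ℝ := (f.arity : ℝ) + 1
  have hN : 0 < N := by positivity
  obtain ⟨d, hd⟩ := exists_pow_lt_of_lt_one (x := 1 / (4 * N)) (y := (1 / 2 : ℝ))
    (by positivity) (by norm_num)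
  refine ⟨d + 1, by omega, fun j hj => ?_⟩
  obtain ⟨m, hm⟩ := exists_pow_lt_of_lt_one (x := 1 / (4 * N ^ j)) (y := (17 / 18 : ℝ))
    (by positivity) (by norm_num)
  refine ⟨(f.iter j).arity * m, fun k => ?_⟩
  rw [iter_add]
  refine (certQuantumComplexity_comp_le (f.iter j) (f.iter k) (m := m) (k := (d + 1) * j)
    (by positivity) ?_ ?_).trans_eq (by ring)
  · calc _ ≤ N ^ j * (1 / (4 * N ^ j)) := mul_le_mul (arity_iter_le f j) hm.le (by positivity)
          (by positivity)
      _ = 1 / 4 := by field_simp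
  · have h1 : (1 / 2 : ℝ) ^ (d + 1) ≤ 1 / (4 * N) := by
      rw [pow_succ]
      have : (0 : ℝ) ≤ (1 / 2) ^ d := by positivity
      linarith
    calc _ ≤ N ^ j * (1 / (4 * N)) ^ j := by
          rw [pow_mul]
          exact mul_le_mul (arity_iter_le f j) (pow_le_pow_left₀ (by positivity) h1 j)
            (by positivity) (by positivity)
      _ = (1 / 4) ^ j := by
          rw [← mul_pow]
          congr 1
          field_simp
      _ ≤ 1 / 4 := pow_le_of_le_one (by norm_num) (by norm_num) hj.ne'

/-! ### Growth rates of sequences satisfying such recurrences. -/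

section Growth

theorem tendsto_const_rpow_one_div {K : ℝ} (hK : 0 < K) :
    Tendsto (fun k : ℕ => K ^ (1 / (k : ℝ))) atTop (𝓝 1) := by
  have h := (tendsto_const_nhds (x := K)).rpow (tendsto_one_div_atTop_nhds_zero_nat (𝕜 := ℝ))
    (Or.inl hK.ne')
  rwa [Real.rpow_zero] at h

theorem tendsto_mul_nat_rpow_one_div {D : ℝ} (hD : 0 < D) :
    Tendsto (fun k : ℕ => (D * k) ^ (1 / (k : ℝ))) atTop (𝓝 1) := by
  have h := (tendsto_const_rpow_one_div hD).mul
    (tendsto_rpow_div.comp tendsto_natCast_atTop_atTop)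
  rw [mul_one] at h
  refine h.congr fun k => ?_
  rw [Real.mul_rpow hD.le (Nat.cast_nonneg k)]
  rfl

theorem rpow_one_div_pow {a : ℝ} (ha : 0 ≤ a) {k : ℕ} (hk : 0 < k) :
    (a ^ (1 / (k : ℝ))) ^ k = a := by
  rw [one_div, Real.rpow_inv_natCast_pow ha hk.ne']

theorem pow_rpow_one_div {a : ℝ} (ha : 0 ≤ a) {k : ℕ} (hk : 0 < k) :
    (a ^ k) ^ (1 / (k : ℝ)) = a := by
  rw [one_div, Real.pow_rpow_inv_natCast ha hk.ne']

/-- The forcing term grows at the same rate as the homogeneous solution, which could produce an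
extra factor linear in `k`; the slack between `α` and `β` absorbs it. -/
theorem exists_le_mul_pow_of_recurrence {u : ℕ → ℝ} {α β A : ℝ} (hα : 0 < α) (hαβ : α < β)
    (hA : 0 ≤ A) {j : ℕ} (hj : 0 < j) (h : ∀ k, u (j + k) ≤ A * α ^ k + α ^ j * u k) :
    ∃ K, 0 < K ∧ ∀ k, u k ≤ K * β ^ k := by
  have hβ : 0 < β := hα.trans hαβ
  have hd : 0 < β ^ j - α ^ j := sub_pos.mpr (pow_lt_pow_left₀ hαβ hα.le hj.ne')
  set S : ℝ := ∑ r ∈ Finset.range j, |u r| / β ^ r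
  have hS : 0 ≤ S := Finset.sum_nonneg fun r _ => by positivity
  have hB : 0 ≤ A / (β ^ j - α ^ j) := by positivity
  -- `S` covers the initial values below `j`, the quotient makes `A ≤ K (β^j − α^j)` for the
  -- induction step, and the 1 ensures positivity.
  refine ⟨S + A / (β ^ j - α ^ j) + 1, by positivity, fun k => ?_⟩
  induction k using Nat.strong_induction_on with
  | _ k ih =>
    rcases lt_or_ge k j with hk | hk
    · have h1 : |u k| / β ^ k ≤ S := Finset.single_le_sum (f := fun r => |u r| / β ^ r)
        (fun r _ => by positivity) (Finset.mem_range.mpr hk)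
      rw [div_le_iff₀ (by positivity)] at h1
      refine (le_abs_self _).trans (h1.trans ?_)
      exact mul_le_mul_of_nonneg_right (by linarith) (by positivity)
    · obtain ⟨i, rfl⟩ := Nat.exists_eq_add_of_le hk
      have h1 := ih i (by omega)
      set K := S + A / (β ^ j - α ^ j) + 1
      have h2 : A ≤ K * (β ^ j - α ^ j) := by
        rw [← div_le_iff₀ hd]
        linarith
      have h3 : α ^ i ≤ β ^ i := pow_le_pow_left₀ hα.le hαβ.le i
      calc u (j + i) ≤ A * α ^ i + α ^ j * u i := h i
        _ ≤ A * β ^ i + α ^ j * (K * β ^ i) := by gcongr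
        _ ≤ K * (β ^ j - α ^ j) * β ^ i + α ^ j * (K * β ^ i) := by gcongr
        _ = K * β ^ (j + i) := by ring

theorem eventually_rpow_one_div_lt {u : ℕ → ℝ} (hu : ∀ k, 0 ≤ u k) {K β γ : ℝ} (hK : 0 < K)
    (hβ : 0 ≤ β) (hβγ : β < γ) (h : ∀ k, u k ≤ K * β ^ k) :
    ∀ᶠ k : ℕ in atTop, u k ^ (1 / (k : ℝ)) < γ := by
  have h1 := (tendsto_const_rpow_one_div hK).mul_const β
  rw [one_mul] at h1
  filter_upwards [h1.eventually_lt_const hβγ, eventually_gt_atTop 0] with k hk hk0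
  refine lt_of_le_of_lt ?_ hk
  calc u k ^ (1 / (k : ℝ)) ≤ (K * β ^ k) ^ (1 / (k : ℝ)) :=
        Real.rpow_le_rpow (hu k) (h k) (by positivity)
    _ = K ^ (1 / (k : ℝ)) * β := by
        rw [Real.mul_rpow hK.le (by positivity), pow_rpow_one_div hβ hk0]

theorem exists_le_mul_pow_of_eventually {u : ℕ → ℝ} {α : ℝ} (hα : 0 < α)
    (h : ∀ᶠ k in atTop, u k ≤ α ^ k) : ∃ K, 0 ≤ K ∧ ∀ k, u k ≤ K * α ^ k := by
  obtain ⟨M, hM⟩ := eventually_atTop.mp h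
  have hS : 0 ≤ ∑ r ∈ Finset.range M, |u r| / α ^ r := Finset.sum_nonneg fun r _ => by positivity
  refine ⟨∑ r ∈ Finset.range M, |u r| / α ^ r + 1, by positivity, fun k => ?_⟩
  rcases lt_or_ge k M with hk | hk
  · have h1 : |u k| / α ^ k ≤ ∑ r ∈ Finset.range M, |u r| / α ^ r :=
      Finset.single_le_sum (f := fun r => |u r| / α ^ r)
        (fun r _ => by positivity) (Finset.mem_range.mpr hk)
    rw [div_le_iff₀ (by positivity)] at h1
    refine (le_abs_self _).trans (h1.trans ?_)
    exact mul_le_mul_of_nonneg_right (by linarith) (by positivity)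
  · refine (hM k hk).trans ?_
    exact le_mul_of_one_le_left (by positivity) (by linarith)

/-- A version of Fekete's lemma for sequences that are submultiplicative up to a factor linear in
the first index. -/
theorem exists_tendsto_of_submultiplicative {u : ℕ → ℝ} (hu : ∀ k, 0 ≤ u k) {D : ℝ} (hD : 0 < D)
    (h : ∀ j k, 0 < j → u (j + k) ≤ D * j * u j * u k) :
    ∃ L, 0 ≤ L ∧ Tendsto (fun k : ℕ => u k ^ (1 / (k : ℝ))) atTop (𝓝 L) := by
  -- The limit is the infimum of these corrected roots: the correction `(D * j) ^ (1 / j)` tends to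
  -- 1, and a single good `j` controls the growth of the whole sequence.
  let b : Set.Ioi 0 → ℝ := fun j => (D * (j : ℕ) * u j) ^ (1 / ((j : ℕ) : ℝ))
  have hpos : ∀ j : ℕ, 0 ≤ D * j * u j := fun j => by have := hu j; positivity
  have hb : ∀ j, 0 ≤ b j := fun j => Real.rpow_nonneg (hpos _) _
  have hbdd : BddBelow (Set.range b) := ⟨0, by rintro _ ⟨j, rfl⟩; exact hb j⟩
  have : Nonempty (Set.Ioi (0 : ℕ)) := ⟨⟨1, Nat.one_pos⟩⟩
  refine ⟨⨅ j, b j, le_ciInf hb, tendsto_order.mpr ⟨fun γ hγ => ?_, fun γ hγ => ?_⟩⟩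
  · have h1 := (tendsto_const_nhds (x := ⨅ j, b j)).div (tendsto_mul_nat_rpow_one_div hD)
      one_ne_zero
    rw [div_one] at h1
    filter_upwards [h1.eventually_const_lt hγ, eventually_gt_atTop 0] with k hk hk0
    refine hk.trans_le ?_
    have hDk : 0 < (D * k) ^ (1 / (k : ℝ)) := by positivity
    change (⨅ j, b j) / (D * k) ^ (1 / (k : ℝ)) ≤ _
    rw [div_le_iff₀ hDk, mul_comm, ← Real.mul_rpow (by positivity) (hu k)]
    exact ciInf_le hbdd (⟨k, hk0⟩ : Set.Ioi (0 : ℕ))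
  · obtain ⟨⟨j, hj⟩, hjγ⟩ := exists_lt_of_ciInf_lt hγ
    obtain ⟨α, hα, hαγ⟩ := exists_between hjγ
    obtain ⟨β, hαβ, hβγ⟩ := exists_between hαγ
    have hα0 : 0 < α := (hb _).trans_lt hα
    have hle : D * j * u j ≤ α ^ j := by
      rw [← rpow_one_div_pow (hpos j) hj]
      exact pow_le_pow_left₀ (hb ⟨j, hj⟩) hα.le j
    obtain ⟨K, hK, hKu⟩ := exists_le_mul_pow_of_recurrence (u := u) hα0 hαβ le_rfl hj fun k => by
      rw [zero_mul, zero_add]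
      exact (h j k hj).trans (mul_le_mul_of_nonneg_right hle (hu k))
    exact eventually_rpow_one_div_lt hu hK (hα0.trans hαβ).le hβγ hKu

/-- For the upper bound take `α` above both limits. Then `q k` is at most a constant times `α ^ k`,
and some fixed `j` has `D * j * c j ≤ α ^ j`, so `r` obeys a linear recurrence of rate `α`. -/
theorem tendsto_max_of_recurrence {q c r : ℕ → ℝ} (hq : ∀ k, 0 ≤ q k) (hc : ∀ k, 0 ≤ c k)
    (hr : ∀ k, 0 ≤ r k) {Lq Lc : ℝ}
    (hLq : Tendsto (fun k : ℕ => q k ^ (1 / (k : ℝ))) atTop (𝓝 Lq))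
    (hLc : Tendsto (fun k : ℕ => c k ^ (1 / (k : ℝ))) atTop (𝓝 Lc)) (hLc0 : 0 ≤ Lc)
    (hqr : ∀ k, q k ≤ 2 * r k) (hcr : ∀ k, c k ≤ r k) {D : ℝ} (hD : 0 < D)
    (h : ∀ j, 0 < j → ∃ E : ℝ, 0 ≤ E ∧ ∀ k, r (j + k) ≤ E * q k + D * j * c j * r k) :
    Tendsto (fun k : ℕ => r k ^ (1 / (k : ℝ))) atTop (𝓝 (max Lq Lc)) := by
  refine tendsto_order.mpr ⟨fun γ hγ => ?_, fun γ hγ => ?_⟩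
  · rcases lt_max_iff.mp hγ with hγ | hγ
    · have h1 := hLq.div (tendsto_const_rpow_one_div two_pos) one_ne_zero
      rw [div_one] at h1
      filter_upwards [h1.eventually_const_lt hγ] with k hk
      refine hk.trans_le ?_
      change q k ^ (1 / (k : ℝ)) / 2 ^ (1 / (k : ℝ)) ≤ _
      rw [div_le_iff₀ (by positivity), mul_comm, ← Real.mul_rpow two_pos.le (hr k)]
      exact Real.rpow_le_rpow (hq k) (hqr k) (by positivity)
    · filter_upwards [hLc.eventually_const_lt hγ] with k hk
      exact hk.trans_le (Real.rpow_le_rpow (hc k) (hcr k) (by positivity))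
  · obtain ⟨α, hα, hαγ⟩ := exists_between hγ
    obtain ⟨β, hαβ, hβγ⟩ := exists_between hαγ
    have hα0 : 0 < α := (hLc0.trans (le_max_right _ _)).trans_lt hα
    have hqα : ∀ᶠ k in atTop, q k ≤ α ^ k := by
      filter_upwards [hLq.eventually_lt_const ((le_max_left _ _).trans_lt hα),
        eventually_gt_atTop 0] with k hk hk0
      rw [← rpow_one_div_pow (hq k) hk0]
      exact pow_le_pow_left₀ (Real.rpow_nonneg (hq k) _) hk.le k
    obtain ⟨K, hK, hKq⟩ := exists_le_mul_pow_of_eventually hα0 hqα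
    have h1 := (tendsto_mul_nat_rpow_one_div hD).mul hLc
    rw [one_mul] at h1
    obtain ⟨j, hjα, hj⟩ := ((h1.eventually_lt_const ((le_max_right _ _).trans_lt hα)).and
      (eventually_gt_atTop 0)).exists
    have hpos : 0 ≤ D * j * c j := by have := hc j; positivity
    have hle : D * j * c j ≤ α ^ j := by
      rw [← rpow_one_div_pow hpos hj]
      refine pow_le_pow_left₀ (Real.rpow_nonneg hpos _) ?_ j
      rw [Real.mul_rpow (by positivity) (hc j)]
      exact hjα.le
    obtain ⟨E, hE, hrec⟩ := h j hj
    obtain ⟨K', hK', hKr⟩ := exists_le_mul_pow_of_recurrence (u := r) (A := E * K) hα0 hαβ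
      (by positivity) hj fun k => by
        refine (hrec k).trans (add_le_add ?_ (mul_le_mul_of_nonneg_right hle (hr k)))
        rw [mul_assoc]
        exact mul_le_mul_of_nonneg_left (hKq k) hE
    exact eventually_rpow_one_div_lt hr hK' (hα0.trans hαβ).le hβγ hKr

end Growth

/-- For every possibly partial Boolean function `f`, the composition limits `Q*(f)`, `C*(f)` and
`Q_C*(f)` exist, and `Q_C*(f) = max {Q*(f), C*(f)}`. -/
theorem theorem2 (f : PartialBoolFun) :
    ∃ qStar cStar qcStar : ℝ,
      HasCompositionLimit (fun g => (quantumComplexity g : ℝ)) f qStar ∧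
      HasCompositionLimit (fun g => (certComplexity g : ℝ)) f cStar ∧
      HasCompositionLimit (fun g => (certQuantumComplexity g : ℝ)) f qcStar ∧
      qcStar = max qStar cStar := by
  obtain ⟨D, hD, hDq⟩ := exists_quantumComplexity_iter_add_le f
  obtain ⟨D', hD', hDr⟩ := exists_certQuantumComplexity_iter_add_le f
  obtain ⟨qStar, -, hq⟩ := exists_tendsto_of_submultiplicative
    (u := fun k => (quantumComplexity (f.iter k) : ℝ)) (fun k => Nat.cast_nonneg _)
    (D := (D : ℝ)) (by exact_mod_cast hD) fun j k hj => by exact_mod_cast hDq j k hj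
  obtain ⟨cStar, hc0, hc⟩ := exists_tendsto_of_submultiplicative
    (u := fun k => (certComplexity (f.iter k) : ℝ)) (fun k => Nat.cast_nonneg _)
    one_pos fun j k hj => by
      -- C is submultiplicative outright; the factor `j ≥ 1` is inserted only to match the form of
      -- the Fekete lemma with constant 1.
      have h1 : certComplexity (f.iter (j + k)) ≤
          j * certComplexity (f.iter j) * certComplexity (f.iter k) := by
        refine (certComplexity_iter_add_le f j k).trans ?_
        rw [mul_assoc]
        exact Nat.le_mul_of_pos_left _ hj
      rw [one_mul]
      exact_mod_cast h1
  refine ⟨qStar, cStar, max qStar cStar, hq, hc, ?_, rfl⟩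
  refine tendsto_max_of_recurrence (q := fun k => (quantumComplexity (f.iter k) : ℝ))
    (c := fun k => (certComplexity (f.iter k) : ℝ)) (fun k => Nat.cast_nonneg _)
    (fun k => Nat.cast_nonneg _) (fun k => Nat.cast_nonneg _) hq hc hc0 (fun k => ?_) (fun k => ?_)
    (D := (D' : ℝ)) (by exact_mod_cast hD') fun j hj => ?_
  · exact_mod_cast quantumComplexity_le_certQuantumComplexity (f.iter k)
  · exact_mod_cast certComplexity_le_certQuantumComplexity (f.iter k)
  · obtain ⟨E, hE⟩ := hDr j hj
    exact ⟨E, Nat.cast_nonneg _, fun k => by exact_mod_cast hE k⟩
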